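/- All graphs are finite, undirected and simple. For a graph $G$, the $m$-degree $m(G)$ is the largest integer $k$ such that $G$ has at least $k$ vertices of degree at least $k-1$. A vertex of $G$ is dense if its degree is at least $m(G)-1$, and $G$ is tight if it has exactly $m(G)$ dense vertices, each of which has degree exactly $m(G)-1$. A b-colouring of $G$ is a map $c:V(G)\to\{1,2,\ldots\}$ with $c(u)\neq c(v)$ for every edge $uv$ such that every colour $i\in c(V(G))$ has a vertex of colour $i$ that is adjacent to a vertex of every colour $j\in c(V(G))\setminus\{i\}$. A tight b-colouring of $G$ is a b-colouring with exactly $m(G)$ colours, that is, with $|c(V(G))|=m(G)$. The problem Tight b-Chromatic Number is to decide, given a tight graph $G$, whether $G$ has a tight b-colouring. **Lemma.** Tight b-Chromatic Number is polynomial-time solvable for $(2P_2+P_1)$-free graphs, that is, for graphs with no induced subgraph isomorphic to the disjoint union of two edges and an isolated vertex. In other words, there are an algorithm and a polynomial $p$ such that, for every tight $(2P_2+P_1)$-free graph $G$ on $n$ vertices, the algorithm, given $G$, decides within $p(n)$ steps whether $G$ has a tight b-colouring. -/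

import Mathlib

/-! ## Graph notions -/

namespace TightB

section Graph

variable {V : Type*} [Fintype V] (G : SimpleGraph V)

open Classical in
/-- The `m`-degree `m(G)`: the largest `k` such that at least `k` vertices have degree at
least `k - 1` (written `k ≤ degree + 1`, which avoids truncated subtraction). The set is
bounded by the number of vertices and contains `0`. -/
noncomputable def mDegree : ℕ :=
  sSup {k : ℕ | k ≤ (Finset.univ.filter fun v : V => k ≤ G.degree v + 1).card}

open Classical in
/-- A vertex is dense if its degree is at least `m(G) - 1`. -/
def IsDense (v : V) : Prop :=
  mDegree G ≤ G.degree v + 1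

open Classical in
/-- `G` is tight if it has exactly `m(G)` dense vertices, each of degree exactly `m(G) - 1`. -/
def IsTight : Prop :=
  (Finset.univ.filter fun v : V => IsDense G v).card = mDegree G ∧
    ∀ v : V, IsDense G v → G.degree v + 1 = mDegree G

variable {G}

/-- `v` is b-chromatic under `c` if it has a neighbour of every colour used by `c` other
than its own colour. -/
def IsBChromaticVertex (c : G.Coloring ℕ+) (v : V) : Prop :=
  ∀ j ∈ Set.range c, j ≠ c v → ∃ w, G.Adj v w ∧ c w = j

/-- A b-colouring: every colour class contains a b-chromatic vertex. -/
def IsBColouring (c : G.Coloring ℕ+) : Prop :=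
  ∀ i ∈ Set.range c, ∃ v, c v = i ∧ IsBChromaticVertex c v

/-- A tight b-colouring: a b-colouring that uses exactly `m(G)` colours. -/
def IsTightBColouring (c : G.Coloring ℕ+) : Prop :=
  IsBColouring c ∧ (Set.range c).ncard = mDegree G

variable (G)

/-- `G` has a tight b-colouring. -/
def HasTightBColouring : Prop :=
  ∃ c : G.Coloring ℕ+, IsTightBColouring c

end Graph

open SimpleGraph in
/-- The graph `2P₂ + P₁`: the disjoint union of two edges and an isolated vertex. -/
def twoP2AddP1 : SimpleGraph ((Fin 2 ⊕ Fin 2) ⊕ Fin 1) :=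
  (pathGraph 2 ⊕g pathGraph 2) ⊕g pathGraph 1

/-- `G` is `H`-free: `H` is not isomorphic to an induced subgraph of `G`. -/
def IsFreeOf {W V : Type*} (H : SimpleGraph W) (G : SimpleGraph V) : Prop :=
  ¬ H.IsIndContained G

/-! ## Machine model

A random access machine with the uniform cost measure, programmed by structured programs.
The machine has registers `0, 1, 2, …` and arrays `0, 1, 2, …` of unbounded length, all
holding natural numbers; a program refers to finitely many registers and arrays, and array
cells are addressed indirectly. The only arithmetic is addition and truncated subtraction,
so that the bit length of the stored numbers grows by at most a constant per step and
polynomial time is the usual polynomial time. -/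

/-- Memory contents. -/
structure State where
  /-- the registers -/
  reg : ℕ → ℕ
  /-- the arrays; `arr a i` is cell `i` of array `a` -/
  arr : ℕ → ℕ → ℕ

/-- Overwrite register `r` by `x`. -/
def State.setReg (s : State) (r x : ℕ) : State :=
  { s with reg := Function.update s.reg r x }

/-- Overwrite cell `i` of array `a` by `x`. -/
def State.setArr (s : State) (a i x : ℕ) : State :=
  { s with arr := Function.update s.arr a (Function.update (s.arr a) i x) }

/-- Expressions: constants, registers, array cells with a computed index, sums and truncated
differences. -/
inductive Expr where
  | lit (x : ℕ)
  | reg (r : ℕ)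
  | cell (a : ℕ) (i : Expr)
  | plus (e f : Expr)
  | minus (e f : Expr)

/-- The value of an expression. -/
def Expr.eval (s : State) : Expr → ℕ
  | .lit x => x
  | .reg r => s.reg r
  | .cell a i => s.arr a (i.eval s)
  | .plus e f => e.eval s + f.eval s
  | .minus e f => e.eval s - f.eval s

/-- The cost of evaluating an expression: one step for each of its nodes. -/
def Expr.cost : Expr → ℕ
  | .lit _ => 1
  | .reg _ => 1
  | .cell _ i => i.cost + 1
  | .plus e f => e.cost + f.cost + 1
  | .minus e f => e.cost + f.cost + 1

/-- Programs. A test succeeds if its value is nonzero. -/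
inductive Prog where
  | skip
  | assign (r : ℕ) (e : Expr)
  | store (a : ℕ) (i e : Expr)
  | seq (p q : Prog)
  | ite (b : Expr) (p q : Prog)
  | loop (b : Expr) (p : Prog)

/-- `Exec p s s' t`: program `p`, started in state `s`, halts in state `s'` after exactly
`t` steps. -/
inductive Exec : Prog → State → State → ℕ → Prop where
  | skip (s : State) : Exec .skip s s 1
  | assign (r : ℕ) (e : Expr) (s : State) :
      Exec (.assign r e) s (s.setReg r (e.eval s)) (e.cost + 1)
  | store (a : ℕ) (i e : Expr) (s : State) :
      Exec (.store a i e) s (s.setArr a (i.eval s) (e.eval s)) (i.cost + e.cost + 1)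
  | seq {p q : Prog} {s s' s'' : State} {t t' : ℕ}
      (hp : Exec p s s' t) (hq : Exec q s' s'' t') : Exec (.seq p q) s s'' (t + t')
  | ite_true {b : Expr} {p q : Prog} {s s' : State} {t : ℕ}
      (hb : b.eval s ≠ 0) (hp : Exec p s s' t) : Exec (.ite b p q) s s' (b.cost + 1 + t)
  | ite_false {b : Expr} {p q : Prog} {s s' : State} {t : ℕ}
      (hb : b.eval s = 0) (hq : Exec q s s' t) : Exec (.ite b p q) s s' (b.cost + 1 + t)
  | loop_true {b : Expr} {p : Prog} {s s' s'' : State} {t t' : ℕ}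
      (hb : b.eval s ≠ 0) (hp : Exec p s s' t) (hl : Exec (.loop b p) s' s'' t') :
      Exec (.loop b p) s s'' (b.cost + 1 + t + t')
  | loop_false {b : Expr} {p : Prog} {s : State}
      (hb : b.eval s = 0) : Exec (.loop b p) s s (b.cost + 1)

/-- Execution is deterministic: the final state and the number of steps are determined by
the program and the initial state. -/
theorem Exec.deterministic {p : Prog} {s s₁ s₂ : State} {t₁ t₂ : ℕ}
    (h₁ : Exec p s s₁ t₁) (h₂ : Exec p s s₂ t₂) : s₁ = s₂ ∧ t₁ = t₂ := by
  induction h₁ generalizing s₂ t₂ with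
  | skip => cases h₂; exact ⟨rfl, rfl⟩
  | assign => cases h₂; exact ⟨rfl, rfl⟩
  | store => cases h₂; exact ⟨rfl, rfl⟩
  | seq _ _ ihp ihq =>
    cases h₂ with
    | seq hp hq =>
      obtain ⟨rfl, rfl⟩ := ihp hp
      obtain ⟨rfl, rfl⟩ := ihq hq
      exact ⟨rfl, rfl⟩
  | ite_true hb _ ih =>
    cases h₂ with
    | ite_true _ hp => obtain ⟨rfl, rfl⟩ := ih hp; exact ⟨rfl, rfl⟩
    | ite_false hb' _ => exact absurd hb' hb
  | ite_false hb _ ih =>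
    cases h₂ with
    | ite_true hb' _ => exact absurd hb hb'
    | ite_false _ hq => obtain ⟨rfl, rfl⟩ := ih hq; exact ⟨rfl, rfl⟩
  | loop_true hb _ _ ihp ihl =>
    cases h₂ with
    | loop_true _ hp hl =>
      obtain ⟨rfl, rfl⟩ := ihp hp
      obtain ⟨rfl, rfl⟩ := ihl hl
      exact ⟨rfl, rfl⟩
    | loop_false hb' => exact absurd hb' hb
  | loop_false hb =>
    cases h₂ with
    | loop_true hb' _ _ => exact absurd hb hb'
    | loop_false _ => exact ⟨rfl, rfl⟩

open Classical in
/-- The input state for a graph on the vertices `0, …, n - 1`: register `0` holds `n`, array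
`0` holds the adjacency matrix row by row (cell `i * n + j` is `1` if `i` and `j` are
adjacent and `0` otherwise), and everything else is `0`. -/
noncomputable def inputState {n : ℕ} (G : SimpleGraph (Fin n)) : State where
  reg r := if r = 0 then n else 0
  arr a k := if a = 0 ∧ ∃ i j : Fin n, G.Adj i j ∧ k = i * n + j then 1 else 0

/-- The decision problem "does `G` satisfy `P`?", restricted to input graphs in the class
`C`, is solvable in polynomial time: one program halts on every finite graph of the class
within a number of steps that is polynomial in the number of vertices, and leaves the
answer (`1` for yes, `0` for no) in register `0`. -/
def PolyTimeSolvableOn (C P : ∀ {n : ℕ}, SimpleGraph (Fin n) → Prop) : Prop :=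
  ∃ (prog : Prog) (time : Polynomial ℕ), ∀ (n : ℕ) (G : SimpleGraph (Fin n)), C G →
    ∃ (s : State) (t : ℕ), Exec prog (inputState G) s t ∧ t ≤ time.eval n ∧
      (P G → s.reg 0 = 1) ∧ (¬ P G → s.reg 0 = 0)

end TightB

namespace TightB

/-! ## Counting terms and their compilation -/

/-! In a tight graph the m(G) colours need m(G) b-chromatic vertices, all of them dense, so every
colour owns exactly one dense vertex and colours can be identified with dense vertices
(`IsDenseColouringOn`). Comparing degrees, a dense vertex sees every other colour exactly once.
Vertices outside `core G` are irrelevant: they are not dense, hence have small degree, and can be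
coloured greedily at the end. What matters is how the non-dense core vertices of colour e divide the
dense non-neighbours of e among them: their dense neighbourhoods form a partition of that set.

In a (2P₂ + P₁)-free graph this partition has more than one part for at most one colour d
(`IsSplit.eq_of_isSplit`). For every other e with a dense non-neighbour, a single vertex has exactly
the dense non-neighbours of e as its dense neighbours. Matching dense vertices with such vertices
only requires comparing, for each subset of the dense vertices, two cardinalities. The vertices left
for d must be independent. This gives `Criterion`. It is also sufficient, because a dense vertex has
as many non-dense neighbours as dense non-neighbours: the matched vertices use up all its non-dense
neighbours, apart from one if d is among its non-neighbours.

The criterion is expressible by one fixed term with nested sums over the vertices, and such a term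
compiles to nested loops of polynomial length. Density is expressed as having maximum degree, so
m(G) itself is never computed. -/

/-- Counting terms: arithmetic terms over named variables and one array, closed under
summation of a variable over `0, …, n - 1`. -/
inductive CountTerm where
  | lit (x : ℕ)
  | var (x : ℕ)
  | cell (t : CountTerm)
  | plus (t u : CountTerm)
  | minus (t u : CountTerm)
  | sum (x : ℕ) (t : CountTerm)

namespace CountTerm

/-- The value of a term for the bound `n`, the array `a` and the assignment `env`. -/
def eval (n : ℕ) (a : ℕ → ℕ) (env : ℕ → ℕ) : CountTerm → ℕ
  | lit x => x
  | var x => env x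
  | cell t => a (t.eval n a env)
  | plus t u => t.eval n a env + u.eval n a env
  | minus t u => t.eval n a env - u.eval n a env
  | sum x t => ∑ i ∈ Finset.range n, t.eval n a (Function.update env x i)

/-- The body of the loop that evaluates a sum: `p` leaves the summand in register `j + 2`,
register `j` accumulates, register `j + 1` counts. -/
def sumBody (p : Prog) (j : ℕ) : Prog :=
  .seq p (.seq (.assign j (.plus (.reg j) (.reg (j + 2))))
    (.assign (j + 1) (.plus (.reg (j + 1)) (.lit 1))))

/-- A program that leaves the value of the term in register `j` and does not touch the lower
registers; the variable `x` is stored in register `ρ x` and the bound in register `0`. -/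
def compile : CountTerm → (ℕ → ℕ) → ℕ → Prog
  | lit x, _, j => .assign j (.lit x)
  | var x, ρ, j => .assign j (.reg (ρ x))
  | cell t, ρ, j => .seq (t.compile ρ j) (.assign j (.cell 0 (.reg j)))
  | plus t u, ρ, j => .seq (t.compile ρ j)
      (.seq (u.compile ρ (j + 1)) (.assign j (.plus (.reg j) (.reg (j + 1)))))
  | minus t u, ρ, j => .seq (t.compile ρ j)
      (.seq (u.compile ρ (j + 1)) (.assign j (.minus (.reg j) (.reg (j + 1)))))
  | sum x t, ρ, j => .seq (.assign j (.lit 0)) (.seq (.assign (j + 1) (.lit 0))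
      (.loop (.minus (.reg 0) (.reg (j + 1)))
        (sumBody (t.compile (Function.update ρ x (j + 1)) (j + 2)) j)))

open Polynomial in
/-- The running time of the compiled program. -/
noncomputable def time : CountTerm → Polynomial ℕ
  | lit _ => 2
  | var _ => 2
  | cell t => t.time + 3
  | plus t u => t.time + (u.time + 4)
  | minus t u => t.time + (u.time + 4)
  | sum _ t => 2 + (2 + (X * (t.time + 12) + 4))

/-- `Computes p j v s T`: from the state `s`, the program `p` halts after `T` steps with
`v` in register `j`, and neither the arrays nor the registers below `j` have changed. -/
def Computes (p : Prog) (j v : ℕ) (s : State) (T : ℕ) : Prop :=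
  ∃ s', Exec p s s' T ∧ s'.arr = s.arr ∧ (∀ r < j, s'.reg r = s.reg r) ∧ s'.reg j = v

/-- Induction on the number k of remaining rounds, the counter being i = n - k and register j
holding the partial sum. A round costs 4 steps for the test, T for the summand and 4 for each of the
two assignments; the final failing test costs 4. -/
theorem exec_sum_loop {p : Prog} {j n T : ℕ} {f : ℕ → ℕ} {s₀ : State} (hj : 0 < j)
    (hn : s₀.reg 0 = n)
    (hp : ∀ s : State, s.arr = s₀.arr → (∀ r < j, s.reg r = s₀.reg r) → s.reg (j + 1) < n →
      Computes p (j + 2) (f (s.reg (j + 1))) s T) :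
    ∀ (k i : ℕ) (s : State), s.arr = s₀.arr → (∀ r < j, s.reg r = s₀.reg r) →
      s.reg (j + 1) = i → i + k = n → s.reg j = ∑ x ∈ Finset.range i, f x →
      Computes (.loop (.minus (.reg 0) (.reg (j + 1))) (sumBody p j)) j
        (∑ x ∈ Finset.range n, f x) s (k * (T + 12) + 4) := by
  intro k
  induction k with
  | zero =>
    intro i s ha hr hi hik hs
    obtain rfl : i = n := by omega
    refine ⟨s, ?_, rfl, fun _ _ => rfl, hs⟩
    have := Exec.loop_false (b := .minus (.reg 0) (.reg (j + 1))) (p := sumBody p j) (s := s)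
      (by simp [Expr.eval, hr 0 hj, hn, hi])
    simpa [Expr.cost] using this
  | succ k ih =>
    intro i s ha hr hi hik hs
    obtain ⟨s₁, he, ha₁, hr₁, hv₁⟩ := hp s ha hr (by omega)
    rw [hi] at hv₁
    set s₂ := s₁.setReg j (Expr.eval s₁ (.plus (.reg j) (.reg (j + 2)))) with hs₂
    set s₃ := s₂.setReg (j + 1) (Expr.eval s₂ (.plus (.reg (j + 1)) (.lit 1))) with hs₃
    have hbody : Exec (sumBody p j) s s₃ (T + (4 + 4)) :=
      .seq he (.seq (.assign _ _ _) (.assign _ _ _))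
    have h₁j : s₁.reg j = s.reg j := hr₁ j (by omega)
    have h₁j' : s₁.reg (j + 1) = s.reg (j + 1) := hr₁ (j + 1) (by omega)
    have h₃j : s₃.reg j = s.reg j + f i := by
      simp [hs₃, hs₂, State.setReg, Expr.eval, Function.update_of_ne, h₁j, hv₁]
    have h₃j' : s₃.reg (j + 1) = i + 1 := by
      simp [hs₃, hs₂, State.setReg, Expr.eval, Function.update_of_ne, h₁j', hi]
    have h₃r : ∀ r < j, s₃.reg r = s.reg r := by
      intro r hrj
      have h1 : r ≠ j + 1 := by omega
      have h2 : r ≠ j := by omega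
      simp [hs₃, hs₂, State.setReg, Function.update_of_ne h1, Function.update_of_ne h2,
        hr₁ r (by omega)]
    have h₃a : s₃.arr = s.arr := ha₁
    obtain ⟨s', hl, ha', hr', hv'⟩ := ih (i + 1) s₃ (h₃a.trans ha)
      (fun r h => (h₃r r h).trans (hr r h)) h₃j' (by omega)
      (by rw [h₃j, hs, Finset.sum_range_succ])
    refine ⟨s', ?_, ha'.trans h₃a, fun r h => (hr' r h).trans (h₃r r h), hv'⟩
    have hb : Expr.eval s (.minus (.reg 0) (.reg (j + 1))) ≠ 0 := by
      simp only [Expr.eval, hr 0 hj, hn, hi]; omega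
    have := Exec.loop_true hb hbody hl
    have hT : (Expr.minus (.reg 0) (.reg (j + 1))).cost + 1 + (T + (4 + 4)) +
        (k * (T + 12) + 4) = (k + 1) * (T + 12) + 4 := by
      simp only [Expr.cost]; ring
    rwa [hT] at this

theorem computes_binary {p q : Prog} {j v w z T U : ℕ} {s : State} {e : Expr}
    (hp : Computes p j v s T)
    (hq : ∀ s' : State, s'.arr = s.arr → (∀ r < j, s'.reg r = s.reg r) →
      Computes q (j + 1) w s' U)
    (he : ∀ s' : State, s'.reg j = v → s'.reg (j + 1) = w → e.eval s' = z)
    (hc : e.cost = 3) :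
    Computes (.seq p (.seq q (.assign j e))) j z s (T + (U + 4)) := by
  obtain ⟨s₁, h₁, ha₁, hr₁, hv₁⟩ := hp
  obtain ⟨s₂, h₂, ha₂, hr₂, hv₂⟩ := hq s₁ ha₁ hr₁
  refine ⟨s₂.setReg j (e.eval s₂), ?_, ha₂.trans ha₁, ?_, ?_⟩
  · have := Exec.seq h₁ (Exec.seq h₂ (Exec.assign j e s₂))
    rwa [hc] at this
  · intro r h
    simp [State.setReg, Function.update_of_ne h.ne, hr₂ r (by omega), hr₁ r h]
  · simpa [State.setReg] using he s₂ ((hr₂ j (by omega)).trans hv₁) hv₂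

/-- The variables and the bound live in registers below j, and compiled code writes only to
registers from j on, so evaluating an operand or a summand never disturbs them. The step count
depends on n alone, which is why it is exact. -/
theorem computes_compile (n : ℕ) (t : CountTerm) : ∀ (ρ env : ℕ → ℕ) (j : ℕ) (s : State), 0 < j →
    (∀ x, ρ x < j) → (∀ x, s.reg (ρ x) = env x) → s.reg 0 = n →
    Computes (t.compile ρ j) j (t.eval n (s.arr 0) env) s (t.time.eval n) := by
  induction t with
  | lit x =>
    intro ρ env j s hj hρ he hn
    refine ⟨s.setReg j x, ?_, rfl, fun r h => ?_, by simp [State.setReg, eval]⟩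
    · simpa [time, compile, Expr.eval, Expr.cost] using Exec.assign j (.lit x) s
    · simp [State.setReg, Function.update_of_ne h.ne]
  | var x =>
    intro ρ env j s hj hρ he hn
    refine ⟨s.setReg j (s.reg (ρ x)), ?_, rfl, fun r h => ?_, by simp [State.setReg, eval, he]⟩
    · simpa [time, compile, Expr.eval, Expr.cost] using Exec.assign j (.reg (ρ x)) s
    · simp [State.setReg, Function.update_of_ne h.ne]
  | cell t ih =>
    intro ρ env j s hj hρ he hn
    obtain ⟨s₁, h₁, ha₁, hr₁, hv₁⟩ := ih ρ env j s hj hρ he hn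
    refine ⟨s₁.setReg j (s₁.arr 0 (s₁.reg j)), ?_, ha₁, fun r h => ?_, ?_⟩
    · simpa [time, compile, Expr.eval, Expr.cost] using
        Exec.seq h₁ (Exec.assign j (.cell 0 (.reg j)) s₁)
    · simp [State.setReg, Function.update_of_ne h.ne, hr₁ r h]
    · simp [State.setReg, eval, hv₁, ha₁]
  | plus t u iht ihu =>
    intro ρ env j s hj hρ he hn
    have := computes_binary (e := .plus (.reg j) (.reg (j + 1))) (iht ρ env j s hj hρ he hn)
      (fun s' ha hr => ha ▸ ihu ρ env (j + 1) s' (by omega)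
        (fun x => (hρ x).trans (Nat.lt_succ_self j)) (fun x => (hr _ (hρ x)).trans (he x))
        ((hr 0 hj).trans hn))
      (fun s' h h' => by simp only [Expr.eval, h, h']; rfl) rfl
    simpa [time, compile, eval] using this
  | minus t u iht ihu =>
    intro ρ env j s hj hρ he hn
    have := computes_binary (e := .minus (.reg j) (.reg (j + 1))) (iht ρ env j s hj hρ he hn)
      (fun s' ha hr => ha ▸ ihu ρ env (j + 1) s' (by omega)
        (fun x => (hρ x).trans (Nat.lt_succ_self j)) (fun x => (hr _ (hρ x)).trans (he x))
        ((hr 0 hj).trans hn))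
      (fun s' h h' => by simp only [Expr.eval, h, h']; rfl) rfl
    simpa [time, compile, eval] using this
  | sum x t ih =>
    intro ρ env j s hj hρ he hn
    set s₂ := (s.setReg j 0).setReg (j + 1) 0 with hs₂
    have hr₂ : ∀ r < j, s₂.reg r = s.reg r := by
      intro r h
      have h1 : r ≠ j + 1 := by omega
      simp [hs₂, State.setReg, Function.update_of_ne h1, Function.update_of_ne h.ne]
    obtain ⟨s', hl, ha', hr', hv'⟩ := exec_sum_loop
      (p := t.compile (Function.update ρ x (j + 1)) (j + 2)) (T := t.time.eval n)
      (f := fun i => t.eval n (s.arr 0) (Function.update env x i)) hj hn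
      (by
        intro s' ha hr _
        have := ih (Function.update ρ x (j + 1)) (Function.update env x (s'.reg (j + 1))) (j + 2)
          s' (by omega) (fun y => ?_) (fun y => ?_) ((hr 0 hj).trans hn)
        · rwa [ha] at this
        · rcases eq_or_ne y x with rfl | h
          · simp
          · rw [Function.update_of_ne h]; have := hρ y; omega
        · rcases eq_or_ne y x with rfl | h
          · simp
          · rw [Function.update_of_ne h, Function.update_of_ne h, hr _ (hρ y), he])
      n 0 s₂ rfl hr₂ (by simp [hs₂, State.setReg]) (by omega)
      (by simp [hs₂, State.setReg, Function.update_of_ne])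
    refine ⟨s', ?_, ha', fun r h => (hr' r h).trans (hr₂ r h), hv'⟩
    have := Exec.seq (Exec.assign j (.lit 0) s) (Exec.seq (Exec.assign (j + 1) (.lit 0) _) hl)
    simpa [time, compile, Expr.cost] using this

end CountTerm

/-- A problem that is defined by a counting term over the adjacency matrix is solvable in
polynomial time. -/
theorem PolyTimeSolvableOn.of_term {C P : ∀ {n : ℕ}, SimpleGraph (Fin n) → Prop} (φ : CountTerm)
    (h : ∀ (n : ℕ) (G : SimpleGraph (Fin n)), C G →
      (φ.eval n ((inputState G).arr 0) (fun _ => n) ≠ 0 ↔ P G)) :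
    PolyTimeSolvableOn C P := by
  -- The value v becomes 1 - (1 - v), which is 1 or 0; this costs the additional 6 steps. All free
  -- variables are read from register 0, whence the constant assignment n.
  refine ⟨.seq (φ.compile (fun _ => 0) 1) (.assign 0 (.minus (.lit 1) (.minus (.lit 1) (.reg 1)))),
    φ.time + 6, fun n G hG => ?_⟩
  obtain ⟨s, he, -, -, hv⟩ := φ.computes_compile n (fun _ => 0) (fun _ => n) 1 (inputState G)
    one_pos (fun _ => one_pos) (fun _ => rfl) rfl
  refine ⟨_, _, .seq he (.assign _ _ _), ?_, fun hP => ?_, fun hP => ?_⟩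
  · simp [Expr.cost]
  · have := (h n G hG).2 hP
    simp only [State.setReg, Function.update_self, Expr.eval, hv]
    omega
  · have := mt (h n G hG).1 hP
    simp only [State.setReg, Function.update_self, Expr.eval, hv]
    omega

end TightB

namespace TightB

/-! ## Tight graphs -/

section Free

variable {V : Type*} {G : SimpleGraph V}

/-- `w` is a non-neighbour of `e` other than `e` itself. -/
def NonAdj (G : SimpleGraph V) (e w : V) : Prop :=
  e ≠ w ∧ ¬ G.Adj e w

theorem NonAdj.symm {e w : V} (h : NonAdj G e w) : NonAdj G w e :=
  ⟨h.1.symm, fun h' => h.2 h'.symm⟩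

/-- Two disjoint edges and a vertex without edges between them do not occur in a
`(2P₂ + P₁)`-free graph. -/
theorem IsFreeOf.false_of_adj (h : IsFreeOf twoP2AddP1 G) {a b c d e : V} (hab : G.Adj a b)
    (hcd : G.Adj c d) (hac : ¬ G.Adj a c) (had : ¬ G.Adj a d) (hbc : ¬ G.Adj b c)
    (hbd : ¬ G.Adj b d) (hea : NonAdj G e a) (heb : NonAdj G e b) (hec : NonAdj G e c)
    (hed : NonAdj G e d) : False := by
  have hca : ¬ G.Adj c a := fun h' => hac h'.symm
  have hda : ¬ G.Adj d a := fun h' => had h'.symm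
  have hcb : ¬ G.Adj c b := fun h' => hbc h'.symm
  have hdb : ¬ G.Adj d b := fun h' => hbd h'.symm
  have hac' : a ≠ c := by rintro rfl; exact hbc hab.symm
  have had' : a ≠ d := by rintro rfl; exact hac hcd.symm
  have hbc' : b ≠ c := by rintro rfl; exact hbd hcd
  have hbd' : b ≠ d := by rintro rfl; exact hbc hcd.symm
  let f : (Fin 2 ⊕ Fin 2) ⊕ Fin 1 → V := Sum.elim (Sum.elim ![a, b] ![c, d]) ![e]
  have hinj : Function.Injective f := by
    rintro ((x | x) | x) ((y | y) | y) <;> fin_cases x <;> fin_cases y <;>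
      simp [f, hab.ne, hab.ne', hcd.ne, hcd.ne', hac', hac'.symm, had', had'.symm, hbc', hbc'.symm,
        hbd', hbd'.symm, hea.1, hea.symm.1, heb.1, heb.symm.1, hec.1, hec.symm.1, hed.1,
        hed.symm.1]
  have hadj : ∀ x y, G.Adj (f x) (f y) ↔ twoP2AddP1.Adj x y := by
    rintro ((x | x) | x) ((y | y) | y) <;> fin_cases x <;> fin_cases y <;>
      simp [f, twoP2AddP1, SimpleGraph.pathGraph_adj, hab, hab.symm, hcd, hcd.symm, hac, hca, had,
        hda, hbc, hcb, hbd, hdb, hea.2, hea.symm.2, heb.2, heb.symm.2, hec.2, hec.symm.2, hed.2,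
        hed.symm.2]
  exact h ⟨⟨⟨f, hinj⟩, hadj _ _⟩⟩

end Free

section Structure

variable {V : Type*} [Fintype V] {G : SimpleGraph V}

open Classical in
theorem mDegree_pos [Nonempty V] : 0 < mDegree G := by
  refine Nat.succ_le_iff.1 (le_csSup
    ⟨Fintype.card V, fun k hk => le_trans hk (Finset.card_le_univ _)⟩ ?_)
  simpa [Nat.succ_le_iff] using Fintype.card_pos

open Classical in
/-- The dense vertices of a tight graph are those of maximum degree. -/
theorem IsTight.isDense_iff (h : IsTight G) (v : V) :
    IsDense G v ↔ ∀ w, G.degree w ≤ G.degree v := by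
  have : Nonempty V := ⟨v⟩
  constructor
  · intro hv w
    by_contra! hw
    have h1 := h.2 v hv
    have h2 := h.2 w (by unfold IsDense; omega)
    omega
  · intro hv
    -- As m(G) is positive, tightness supplies a dense vertex to compare with.
    have hpos : 0 < (Finset.univ.filter fun v : V => IsDense G v).card := by
      rw [h.1]; exact mDegree_pos
    obtain ⟨w, hw⟩ := Finset.card_pos.1 hpos
    have hw' : IsDense G w := (Finset.mem_filter.1 hw).2
    have := hv w
    unfold IsDense at *
    omega

/-- A colouring of the vertices in `S` by dense vertices: each dense vertex has its own
colour and a neighbour of every other colour. -/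
structure IsDenseColouringOn (κ : V → V) (S : Set V) : Prop where
  dense : ∀ v ∈ S, IsDense G (κ v)
  self : ∀ d, IsDense G d → κ d = d
  proper : ∀ u ∈ S, ∀ v ∈ S, G.Adj u v → κ u ≠ κ v
  exists_adj : ∀ d e, IsDense G d → IsDense G e → d ≠ e → ∃ w, G.Adj d w ∧ κ w = e

/-- The dense vertices and their neighbours. -/
def core (G : SimpleGraph V) : Set V :=
  {v | IsDense G v ∨ ∃ d, IsDense G d ∧ G.Adj d v}

-- A non-dense vertex has fewer than m(G) - 1 neighbours, while m(G) colours are available.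
open Classical in
theorem exists_colour_avoiding_neighbours (h : IsTight G) (κ : V → V) {v : V}
    (hv : ¬ IsDense G v) : ∃ d, IsDense G d ∧ ∀ w, G.Adj v w → κ w ≠ d := by
  by_contra! hc
  have hsub : (Finset.univ.filter fun v : V => IsDense G v) ⊆ (G.neighborFinset v).image κ := by
    intro d hd
    obtain ⟨w, hw, rfl⟩ := hc d (Finset.mem_filter.1 hd).2
    exact Finset.mem_image.2 ⟨w, by simpa using hw, rfl⟩
  have h1 := (Finset.card_le_card hsub).trans Finset.card_image_le
  rw [h.1, SimpleGraph.card_neighborFinset_eq_degree] at h1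
  exact hv (by unfold IsDense; omega)

-- Greedy colouring, one vertex at a time. A vertex outside the core has no dense neighbour, so
-- changing its colour cannot spoil what the dense vertices see.
open Classical in
theorem IsDenseColouringOn.exists_extension (h : IsTight G) {κ : V → V}
    (hκ : IsDenseColouringOn (G := G) κ (core G)) :
    ∃ κ', IsDenseColouringOn (G := G) κ' Set.univ := by
  suffices ∀ T : Finset V, ∃ κ' : V → V, IsDenseColouringOn (G := G) κ' (core G ∪ T) by
    obtain ⟨κ', h'⟩ := this Finset.univ
    exact ⟨κ', by simpa using h'⟩
  intro T
  induction T using Finset.induction_on with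
  | empty => exact ⟨κ, by simpa using hκ⟩
  | insert v T hvT ih =>
    obtain ⟨κ', h'⟩ := ih
    by_cases hv : v ∈ core G ∪ T
    · refine ⟨κ', ?_⟩
      have : core G ∪ ((insert v T : Finset V) : Set V) = core G ∪ T := by
        rw [Finset.coe_insert, Set.union_insert, Set.insert_eq_of_mem hv]
      rwa [this]
    have hvd : ¬ IsDense G v := fun hd => hv (Or.inl (Or.inl hd))
    have hva : ∀ d, IsDense G d → ¬ G.Adj d v := fun d hd ha => hv (Or.inl (Or.inr ⟨d, hd, ha⟩))
    obtain ⟨d, hd, hdv⟩ := exists_colour_avoiding_neighbours h κ' hvd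
    have hS : ∀ u, u ∈ core G ∪ ((insert v T : Finset V) : Set V) → u ≠ v →
        u ∈ core G ∪ (T : Set V) := by
      intro u hu huv
      simpa [huv] using hu
    refine ⟨Function.update κ' v d, ⟨?_, ?_, ?_, ?_⟩⟩
    · intro u hu
      rcases eq_or_ne u v with rfl | huv
      · simpa using hd
      · rw [Function.update_of_ne huv]; exact h'.dense u (hS u hu huv)
    · intro e he
      rw [Function.update_of_ne (by rintro rfl; exact hvd he)]
      exact h'.self e he
    · intro u hu w hw huw
      rcases eq_or_ne u v with rfl | huv
      · rw [Function.update_self, Function.update_of_ne huw.ne']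
        exact (hdv w huw).symm
      · rcases eq_or_ne w v with rfl | hwv
        · rw [Function.update_self, Function.update_of_ne huv]
          exact hdv u huw.symm
        · rw [Function.update_of_ne huv, Function.update_of_ne hwv]
          exact h'.proper u (hS u hu huv) w (hS w hw hwv) huw
    · intro e f he hf hef
      obtain ⟨w, hw, hwf⟩ := h'.exists_adj e f he hf hef
      refine ⟨w, hw, ?_⟩
      rw [Function.update_of_ne (by rintro rfl; exact hva e he hw)]
      exact hwf

-- Choosing one b-chromatic vertex per colour gives m(G) distinct dense vertices, hence all of them.
-- Replacing each colour by its chosen vertex gives κ.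
open Classical in
theorem HasTightBColouring.exists_isDenseColouringOn (h : IsTight G)
    (hc : HasTightBColouring G) : ∃ κ, IsDenseColouringOn (G := G) κ Set.univ := by
  obtain ⟨c, hb, hm⟩ := hc
  rcases isEmpty_or_nonempty V with hV | hV
  · exact ⟨id, ⟨fun v => hV.elim v, fun v => hV.elim v, fun v => hV.elim v, fun v => hV.elim v⟩⟩
  have hfin : (Set.range c).Finite := Set.finite_range c
  choose! b hbc hbb using hb
  have hrange : ∀ v, c v ∈ Set.range c := fun v => ⟨v, rfl⟩
  -- a b-chromatic vertex is dense
  have hbd : ∀ i ∈ Set.range c, IsDense G (b i) := by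
    intro i hi
    have hsub : hfin.toFinset ⊆ insert i ((G.neighborFinset (b i)).image c) := by
      intro j hj
      rw [Set.Finite.mem_toFinset] at hj
      rcases eq_or_ne j i with rfl | hji
      · exact Finset.mem_insert_self _ _
      · obtain ⟨w, hw, rfl⟩ := hbb i hi j hj (by rwa [hbc i hi])
        exact Finset.mem_insert_of_mem (Finset.mem_image.2 ⟨w, by simpa using hw, rfl⟩)
    have h1 := (Finset.card_le_card hsub).trans (Finset.card_insert_le _ _)
    have h2 : ((G.neighborFinset (b i)).image c).card ≤ G.degree (b i) := Finset.card_image_le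
    rw [← Set.ncard_eq_toFinset_card _ hfin, hm] at h1
    unfold IsDense
    omega
  have hinj : Set.InjOn b hfin.toFinset := by
    intro i hi j hj hij
    rw [Finset.mem_coe, Set.Finite.mem_toFinset] at hi hj
    rw [← hbc i hi, ← hbc j hj, hij]
  have himage : hfin.toFinset.image b = Finset.univ.filter fun v : V => IsDense G v := by
    apply Finset.eq_of_subset_of_card_le
    · intro d hd
      obtain ⟨i, hi, rfl⟩ := Finset.mem_image.1 hd
      exact Finset.mem_filter.2 ⟨Finset.mem_univ _, hbd i (by simpa using hi)⟩
    · rw [h.1, Finset.card_image_of_injOn hinj, ← Set.ncard_eq_toFinset_card _ hfin, hm]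
  have hself : ∀ d, IsDense G d → b (c d) = d := by
    intro d hd
    have : d ∈ hfin.toFinset.image b := by rw [himage]; simpa using hd
    obtain ⟨i, hi, rfl⟩ := Finset.mem_image.1 this
    rw [hbc i (by simpa using hi)]
  refine ⟨fun v => b (c v), ⟨fun v _ => hbd _ (hrange v), hself, ?_, ?_⟩⟩
  · intro u _ v _ huv heq
    apply c.valid huv
    rw [← hbc _ (hrange u), ← hbc _ (hrange v)]
    exact congrArg c heq
  · intro d e hd he hde
    have hne : c e ≠ c (b (c d)) := by
      rw [hself d hd]
      intro hce
      apply hde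
      rw [← hself d hd, ← hself e he, hce]
    obtain ⟨w, hw, hwe⟩ := hbb (c d) (hrange d) (c e) (hrange e) hne
    rw [hself d hd] at hw
    exact ⟨w, hw, by rw [hwe, hself e he]⟩

open Classical in
theorem IsDenseColouringOn.hasTightBColouring (h : IsTight G) {κ : V → V}
    (hκ : IsDenseColouringOn (G := G) κ Set.univ) : HasTightBColouring G := by
  let ι : V → ℕ+ := fun v => Nat.succPNat (Fintype.equivFin V v)
  have hι : Function.Injective ι := fun u v huv =>
    (Fintype.equivFin V).injective (Fin.ext (Nat.succPNat_injective huv))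
  let c : G.Coloring ℕ+ := SimpleGraph.Coloring.mk (fun v => ι (κ v))
    (fun {u v} huv heq => hκ.proper u trivial v trivial huv (hι heq))
  have hcv : ∀ v, c v = ι (κ v) := fun _ => rfl
  refine ⟨c, ?_, ?_⟩
  · rintro _ ⟨v, rfl⟩
    have hd := hκ.dense v trivial
    refine ⟨κ v, by rw [hcv, hcv, hκ.self _ hd], ?_⟩
    rintro _ ⟨w, rfl⟩ hne
    have hne' : κ v ≠ κ w := by
      rintro heq
      exact hne (by rw [hcv, hcv, hκ.self _ hd, heq])
    obtain ⟨x, hx, hxw⟩ := hκ.exists_adj _ _ hd (hκ.dense w trivial) hne'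
    exact ⟨x, hx, by rw [hcv, hcv, hxw]⟩
  · have : Set.range c = ι '' {d | IsDense G d} := by
      ext i
      constructor
      · rintro ⟨v, rfl⟩
        exact ⟨κ v, hκ.dense v trivial, rfl⟩
      · rintro ⟨d, hd, rfl⟩
        exact ⟨d, by rw [hcv, hκ.self d hd]⟩
    rw [this, Set.ncard_image_of_injective _ hι, ← h.1, ← Set.ncard_coe_finset]
    congr 1
    ext; simp

open Classical in
/-- A dense vertex has as many non-dense neighbours as dense non-neighbours. -/
theorem IsTight.card_nonDense_neighbours (h : IsTight G) {e : V} (he : IsDense G e) :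
    (Finset.univ.filter fun w : V => ¬ IsDense G w ∧ G.Adj e w).card =
      (Finset.univ.filter fun w : V => IsDense G w ∧ NonAdj G e w).card := by
  have h1 := h.2 e he
  have h2 := h.1
  -- The m(G) - 1 other dense vertices and the m(G) - 1 neighbours of e have the dense neighbours of
  -- e in common; the remainders have equal size.
  have h3 : (Finset.univ.filter fun v : V => IsDense G v) = insert e
      ((Finset.univ.filter fun w : V => IsDense G w ∧ NonAdj G e w) ∪
        (Finset.univ.filter fun w : V => IsDense G w ∧ G.Adj e w)) := by
    ext w
    have : e = w → IsDense G w := by rintro rfl; exact he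
    simp only [Finset.mem_filter, Finset.mem_univ, true_and, Finset.mem_insert, Finset.mem_union]
    unfold NonAdj
    rw [eq_comm (a := w)]
    tauto
  have h4 : G.neighborFinset e = (Finset.univ.filter fun w : V => ¬ IsDense G w ∧ G.Adj e w) ∪
        (Finset.univ.filter fun w : V => IsDense G w ∧ G.Adj e w) := by
    ext w
    simp only [Finset.mem_filter, Finset.mem_univ, true_and, Finset.mem_union,
      SimpleGraph.mem_neighborFinset]
    tauto
  rw [h3, Finset.card_insert_of_notMem (by
    simp only [Finset.mem_filter, Finset.mem_univ, true_and, Finset.mem_union]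
    exact fun h' => h'.elim (fun h' => h'.2.1 rfl) (fun h' => G.irrefl h'.2)),
    Finset.card_union_of_disjoint] at h2
  · rw [← SimpleGraph.card_neighborFinset_eq_degree, h4, Finset.card_union_of_disjoint] at h1
    · omega
    · rw [Finset.disjoint_left]
      simp +contextual
  · rw [Finset.disjoint_left]
    intro w hw hw'
    simp only [Finset.mem_filter, Finset.mem_univ, true_and] at hw hw'
    exact hw.2.2 hw'.2

end Structure

end TightB

namespace TightB

/-! ## The criterion -/

section Criterion

variable {V : Type*} [Fintype V] (G : SimpleGraph V)

open Classical in
/-- The counting condition that allows every dense vertex `e` outside `X` with a dense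
non-neighbour to be assigned its own non-dense vertex outside `L` whose dense neighbours are
the dense non-neighbours of `e`. -/
def CountCondition (X L : V → Prop) : Prop :=
  ∀ e, IsDense G e → ¬ X e → (∃ w, IsDense G w ∧ NonAdj G e w) →
    (Finset.univ.filter fun e' : V => IsDense G e' ∧ ¬ X e' ∧
      ∀ w, IsDense G w → (NonAdj G e' w ↔ NonAdj G e w)).card ≤
    (Finset.univ.filter fun u : V => ¬ IsDense G u ∧ ¬ L u ∧
      ∀ w, IsDense G w → (G.Adj u w ↔ NonAdj G e w)).card

/-- `u` is a non-dense vertex with a dense neighbour, and all its dense neighbours are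
non-neighbours of `d`. -/
def IsLeftover (d u : V) : Prop :=
  ¬ IsDense G u ∧ (∃ w, IsDense G w ∧ G.Adj u w) ∧
    ∀ w, IsDense G w → G.Adj u w → NonAdj G d w

/-- Either every dense vertex is matched with one non-dense vertex, or all but one are, and
the vertices left over for the exceptional one are independent. -/
def Criterion : Prop :=
  CountCondition G (fun _ => False) (fun _ => False) ∨
    ∃ d, IsDense G d ∧ (∀ u v, IsLeftover G d u → IsLeftover G d v → ¬ G.Adj u v) ∧
      CountCondition G (fun e => e = d) (IsLeftover G d)

variable {G}

-- Elements may only be sent to elements with the same label, so Hall's condition decouples: one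
-- embedding per label suffices, and images for different labels are disjoint.
open Classical in
theorem exists_injOn_of_card_fiber_le {α β γ : Type*} [Fintype α] [Fintype β] [Nonempty β]
    (p : α → Prop) (q : β → Prop) (f : α → γ) (g : β → γ)
    (h : ∀ a, p a → (Finset.univ.filter fun a' => p a' ∧ f a' = f a).card ≤
      (Finset.univ.filter fun b => q b ∧ g b = f a).card) :
    ∃ φ : α → β, (∀ a, p a → q (φ a) ∧ g (φ a) = f a) ∧
      ∀ a a', p a → p a' → φ a = φ a' → a = a' := by
  have key : ∀ c : γ, ∃ φ : α → β, (∀ a, p a → f a = c → q (φ a) ∧ g (φ a) = c) ∧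
      ∀ a a', p a → f a = c → p a' → f a' = c → φ a = φ a' → a = a' := by
    intro c
    by_cases hc : ∃ a, p a ∧ f a = c
    · obtain ⟨a₀, ha₀, rfl⟩ := hc
      obtain ⟨ψ⟩ := Function.Embedding.nonempty_of_card_le
        (α := Finset.univ.filter fun a' => p a' ∧ f a' = f a₀)
        (β := Finset.univ.filter fun b => q b ∧ g b = f a₀) (by
          rw [Fintype.card_coe, Fintype.card_coe]; exact h a₀ ha₀)
      have hmem : ∀ a, p a → f a = f a₀ → a ∈ Finset.univ.filter fun a' => p a' ∧ f a' = f a₀ :=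
        fun a ha hfa => Finset.mem_filter.2 ⟨Finset.mem_univ _, ha, hfa⟩
      refine ⟨fun a => if ha : a ∈ Finset.univ.filter fun a' => p a' ∧ f a' = f a₀ then ψ ⟨a, ha⟩
        else Classical.arbitrary β, fun a ha hfa => ?_, fun a a' ha hfa ha' hfa' heq => ?_⟩
      · beta_reduce
        rw [dif_pos (hmem a ha hfa)]
        exact (Finset.mem_filter.1 (ψ _).2).2
      · beta_reduce at heq
        rw [dif_pos (hmem a ha hfa), dif_pos (hmem a' ha' hfa')] at heq
        exact congrArg Subtype.val (ψ.injective (Subtype.ext heq))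
    · push Not at hc
      exact ⟨fun _ => Classical.arbitrary β, fun a ha hfa => absurd hfa (hc a ha),
        fun a _ ha hfa => absurd hfa (hc a ha)⟩
  choose φ hφ hinj using key
  refine ⟨fun a => φ (f a) a, fun a ha => hφ (f a) a ha rfl, fun a a' ha ha' heq => ?_⟩
  have hff : f a = f a' := by
    rw [← (hφ (f a) a ha rfl).2, ← (hφ (f a') a' ha' rfl).2]
    exact congrArg g heq
  exact hinj (f a) a a' ha rfl ha' hff.symm (by simpa [hff] using heq)

/-- The assignment provided by the counting condition. -/
theorem CountCondition.exists_assignment {X L : V → Prop} (h : CountCondition G X L) :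
    ∃ u : V → V,
      (∀ e, IsDense G e → ¬ X e → (∃ w, IsDense G w ∧ NonAdj G e w) →
        ¬ IsDense G (u e) ∧ ¬ L (u e) ∧ ∀ w, IsDense G w → (G.Adj (u e) w ↔ NonAdj G e w)) ∧
      ∀ e e', IsDense G e → ¬ X e → (∃ w, IsDense G w ∧ NonAdj G e w) →
        IsDense G e' → ¬ X e' → (∃ w, IsDense G w ∧ NonAdj G e' w) → u e = u e' → e = e' := by
  classical
  rcases isEmpty_or_nonempty V with hV | hV
  · exact ⟨id, fun v => hV.elim v, fun v => hV.elim v⟩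
  obtain ⟨u, hu, hinj⟩ := exists_injOn_of_card_fiber_le
    (fun e : V => IsDense G e ∧ ¬ X e ∧ ∃ w, IsDense G w ∧ NonAdj G e w)
    (fun u : V => ¬ IsDense G u ∧ ¬ L u)
    (fun e => {w | IsDense G w ∧ NonAdj G e w}) (fun u => {w | IsDense G w ∧ G.Adj u w}) (by
      rintro e ⟨he, hX, hw⟩
      refine le_trans (Finset.card_le_card ?_) ((h e he hX hw).trans (Finset.card_le_card ?_))
      · intro e'
        simp only [Finset.mem_filter, Finset.mem_univ, true_and, Set.ext_iff, Set.mem_ofPred_eq]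
        rintro ⟨⟨h1, h2, -⟩, h3⟩
        exact ⟨h1, h2, fun w hw => by simpa [hw] using h3 w⟩
      · intro u
        simp only [Finset.mem_filter, Finset.mem_univ, true_and, Set.ext_iff, Set.mem_ofPred_eq]
        rintro ⟨h1, h2, h3⟩
        exact ⟨⟨h1, h2⟩, fun w => and_congr_right (h3 w)⟩)
  refine ⟨u, fun e h1 h2 h3 => ?_, fun e e' h1 h2 h3 h1' h2' h3' => hinj e e' ⟨h1, h2, h3⟩
    ⟨h1', h2', h3'⟩⟩
  obtain ⟨⟨h4, h5⟩, h6⟩ := hu e ⟨h1, h2, h3⟩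
  refine ⟨h4, h5, fun w hw => ?_⟩
  have := Set.ext_iff.1 h6 w
  simpa [hw] using this

/-- If the dense vertices outside `X` are assigned distinct non-dense vertices as in
`CountCondition`, then a non-dense neighbour of a dense vertex `e` that is not assigned
witnesses a non-neighbour of `e` in `X`. -/
theorem exists_nonAdj_of_not_assigned (h : IsTight G) {X : V → Prop} {u : V → V}
    (hu : ∀ e, IsDense G e → ¬ X e → (∃ w, IsDense G w ∧ NonAdj G e w) →
      ¬ IsDense G (u e) ∧ ∀ w, IsDense G w → (G.Adj (u e) w ↔ NonAdj G e w))
    (hinj : ∀ e e', IsDense G e → ¬ X e → (∃ w, IsDense G w ∧ NonAdj G e w) →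
      IsDense G e' → ¬ X e' → (∃ w, IsDense G w ∧ NonAdj G e' w) → u e = u e' → e = e')
    {e v : V} (he : IsDense G e) (hv : ¬ IsDense G v) (hev : G.Adj e v)
    (hna : ∀ x, IsDense G x → ¬ X x → (∃ w, IsDense G w ∧ NonAdj G x w) → u x ≠ v) :
    ∃ x, IsDense G x ∧ X x ∧ NonAdj G e x := by
  classical
  by_contra! hc
  have hx : ∀ x, IsDense G x → NonAdj G e x →
      ¬ X x ∧ ∃ w, IsDense G w ∧ NonAdj G x w :=
    fun x hx hex => ⟨fun hX => hc x hx hX hex, e, he, hex.symm⟩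
  -- If all dense non-neighbours of e were assigned vertices, these would be distinct non-dense
  -- neighbours of e other than v: one too many.
  have hsub : (Finset.univ.filter fun w : V => IsDense G w ∧ NonAdj G e w).image u ⊆
      (Finset.univ.filter fun w : V => ¬ IsDense G w ∧ G.Adj e w).erase v := by
    intro y hy
    obtain ⟨x, hx', rfl⟩ := Finset.mem_image.1 hy
    obtain ⟨hxd, hex⟩ := (Finset.mem_filter.1 hx').2
    obtain ⟨hX, hw⟩ := hx x hxd hex
    obtain ⟨h1, h2⟩ := hu x hxd hX hw
    exact Finset.mem_erase.2 ⟨hna x hxd hX hw, Finset.mem_filter.2 ⟨Finset.mem_univ _, h1,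
      ((h2 e he).2 hex.symm).symm⟩⟩
  have h1 := Finset.card_le_card hsub
  rw [Finset.card_image_of_injOn, ← h.card_nonDense_neighbours he] at h1
  · have hvm : v ∈ Finset.univ.filter fun w : V => ¬ IsDense G w ∧ G.Adj e w :=
      Finset.mem_filter.2 ⟨Finset.mem_univ _, hv, hev⟩
    have := Finset.card_erase_lt_of_mem hvm
    omega
  · intro x hx₁ y hy₁ hxy
    obtain ⟨hxd, hex⟩ := (Finset.mem_filter.1 (Finset.mem_coe.1 hx₁)).2
    obtain ⟨hyd, hey⟩ := (Finset.mem_filter.1 (Finset.mem_coe.1 hy₁)).2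
    exact hinj x y hxd (hx x hxd hex).1 (hx x hxd hex).2 hyd (hx y hyd hey).1 (hx y hyd hey).2 hxy

/-- If `X` has at most one element `d`, then a dense vertex with the non-neighbour `d` has a
non-dense neighbour that is not assigned. -/
theorem exists_not_assigned (h : IsTight G) {d : V} (hd : IsDense G d) {u : V → V}
    (hu : ∀ e, IsDense G e → e ≠ d → (∃ w, IsDense G w ∧ NonAdj G e w) →
      ∀ w, IsDense G w → (G.Adj (u e) w ↔ NonAdj G e w))
    {e : V} (he : IsDense G e) (hed : NonAdj G e d) :
    ∃ v, ¬ IsDense G v ∧ G.Adj e v ∧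
      ∀ x, IsDense G x → x ≠ d → (∃ w, IsDense G w ∧ NonAdj G x w) → u x ≠ v := by
  classical
  by_contra! hc
  -- Otherwise the dense non-neighbours of e other than d would account for all non-dense neighbours
  -- of e: one too few.
  have hsub : (Finset.univ.filter fun w : V => ¬ IsDense G w ∧ G.Adj e w) ⊆
      ((Finset.univ.filter fun w : V => IsDense G w ∧ NonAdj G e w).erase d).image u := by
    intro v hv
    obtain ⟨hvd, hev⟩ := (Finset.mem_filter.1 hv).2
    obtain ⟨x, hx, hxd, hw, rfl⟩ := hc v hvd hev
    exact Finset.mem_image.2 ⟨x, Finset.mem_erase.2 ⟨hxd, Finset.mem_filter.2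
      ⟨Finset.mem_univ _, hx, ((hu x hx hxd hw e he).1 hev.symm).symm⟩⟩, rfl⟩
  have h1 := (Finset.card_le_card hsub).trans Finset.card_image_le
  rw [h.card_nonDense_neighbours he] at h1
  have hdm : d ∈ Finset.univ.filter fun w : V => IsDense G w ∧ NonAdj G e w :=
    Finset.mem_filter.2 ⟨Finset.mem_univ _, hd, hed⟩
  have := Finset.card_erase_lt_of_mem hdm
  omega

/-- A condition under which the assignment of the non-dense vertices of the core to dense
vertices is a colouring. The vertices that are not assigned get the colour `d`. -/
theorem isDenseColouringOn_of_assignment {X : V → Prop} {u κ : V → V}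
    (hu : ∀ e, IsDense G e → ¬ X e → (∃ w, IsDense G w ∧ NonAdj G e w) →
      ¬ IsDense G (u e) ∧ ∀ w, IsDense G w → (G.Adj (u e) w ↔ NonAdj G e w))
    (hself : ∀ d, IsDense G d → κ d = d)
    (hκu : ∀ e, IsDense G e → ¬ X e → (∃ w, IsDense G w ∧ NonAdj G e w) → κ (u e) = e)
    (hκ : ∀ v ∈ core G, ¬ IsDense G v →
      (∃ e, IsDense G e ∧ ¬ X e ∧ (∃ w, IsDense G w ∧ NonAdj G e w) ∧ u e = v) ∨
      (IsDense G (κ v) ∧ X (κ v) ∧ ¬ G.Adj (κ v) v))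
    (hind : ∀ v ∈ core G, ∀ w ∈ core G, ¬ IsDense G v → ¬ IsDense G w → κ v = κ w → X (κ v) →
      ¬ G.Adj v w)
    (hX : ∀ e d, IsDense G e → IsDense G d → X d → NonAdj G e d → ∃ w, G.Adj e w ∧ κ w = d) :
    IsDenseColouringOn (G := G) κ (core G) := by
  have hnadj : ∀ v ∈ core G, ¬ IsDense G v → IsDense G (κ v) ∧ ¬ G.Adj (κ v) v := by
    intro v hv hvd
    rcases hκ v hv hvd with ⟨e, he, hXe, hw, rfl⟩ | h
    · rw [hκu e he hXe hw]
      exact ⟨he, fun ha => (((hu e he hXe hw).2 e he).1 ha.symm).1 rfl⟩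
    · exact ⟨h.1, h.2.2⟩
  refine ⟨?_, hself, ?_, ?_⟩
  · intro v hv
    by_cases hvd : IsDense G v
    · rwa [hself v hvd]
    · exact (hnadj v hv hvd).1
  · intro v hv w hw hvw heq
    by_cases hvd : IsDense G v
    · rw [hself v hvd] at heq
      by_cases hwd : IsDense G w
      · rw [hself w hwd] at heq
        exact hvw.ne heq
      · exact (hnadj w hw hwd).2 (heq ▸ hvw)
    · by_cases hwd : IsDense G w
      · rw [hself w hwd] at heq
        exact (hnadj v hv hvd).2 (heq ▸ hvw.symm)
      · rcases hκ v hv hvd with ⟨e, he, hXe, hwe, rfl⟩ | h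
        · rw [hκu e he hXe hwe] at heq
          rcases hκ w hw hwd with ⟨e', he', hXe', hwe', rfl⟩ | h'
          · rw [hκu e' he' hXe' hwe'] at heq
            exact hvw.ne (congrArg u heq)
          · exact hXe (heq ▸ h'.2.1)
        · exact hind v hv w hw hvd hwd heq h.2.1 hvw
  · intro d e hd he hde
    by_cases hade : G.Adj d e
    · exact ⟨e, hade, hself e he⟩
    by_cases hXe : X e
    · exact hX d e hd he hXe ⟨hde, hade⟩
    · have hed : NonAdj G e d := ⟨hde.symm, fun h => hade h.symm⟩
      exact ⟨u e, (((hu e he hXe ⟨d, hd, hed⟩).2 d hd).2 hed).symm, hκu e he hXe ⟨d, hd, hed⟩⟩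

open Classical in
/-- The colouring that gives a dense vertex its own colour, the vertex assigned to `e` the
colour `e`, and every other vertex the colour `d`. -/
theorem exists_colour_of_assignment {p : V → Prop} {u : V → V} (d : V)
    (hu : ∀ e, p e → ¬ IsDense G (u e)) (hinj : ∀ e e', p e → p e' → u e = u e' → e = e') :
    ∃ κ : V → V, (∀ d, IsDense G d → κ d = d) ∧ (∀ e, p e → κ (u e) = e) ∧
      ∀ v, ¬ IsDense G v → (∀ e, p e → u e ≠ v) → κ v = d := by
  refine ⟨fun v => if IsDense G v then v else if h : ∃ e, p e ∧ u e = v then h.choose else d,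
    fun v hv => if_pos hv, fun e he => ?_, fun v hv hne => ?_⟩
  · have hex : ∃ e', p e' ∧ u e' = u e := ⟨e, he, rfl⟩
    simp only [if_neg (hu e he), dif_pos hex]
    exact hinj _ _ hex.choose_spec.1 he hex.choose_spec.2
  · have hex : ¬ ∃ e, p e ∧ u e = v := fun ⟨e, he, h⟩ => hne e he h
    simp only [if_neg hv, dif_neg hex]

/-- By `exists_nonAdj_of_not_assigned`, an unmatched non-dense core vertex occurs only if there is
an exceptional d, and all its dense neighbours are then non-neighbours of d: it is a leftover and
can take colour d. By `exists_not_assigned`, every dense non-neighbour of d sees such a vertex. -/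
theorem Criterion.exists_isDenseColouringOn (h : IsTight G) (hC : Criterion G) :
    ∃ κ, IsDenseColouringOn (G := G) κ (core G) := by
  rcases isEmpty_or_nonempty V with hV | hV
  · exact ⟨id, ⟨fun v => hV.elim v, fun v => hV.elim v, fun v => hV.elim v, fun v => hV.elim v⟩⟩
  rcases hC with hC | ⟨d, hd, hind, hC⟩
  · obtain ⟨u, hu, hinj⟩ := hC.exists_assignment
    have hu' : ∀ e, IsDense G e → ¬ False → (∃ w, IsDense G w ∧ NonAdj G e w) →
        ¬ IsDense G (u e) ∧ ∀ w, IsDense G w → (G.Adj (u e) w ↔ NonAdj G e w) :=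
      fun e h1 h2 h3 => ⟨(hu e h1 h2 h3).1, (hu e h1 h2 h3).2.2⟩
    -- The default colour can be arbitrary: it is never used in the core.
    obtain ⟨κ, hself, hκu, -⟩ := exists_colour_of_assignment (G := G) (u := u)
      (p := fun e => IsDense G e ∧ ∃ w, IsDense G w ∧ NonAdj G e w) (Classical.arbitrary V)
      (fun e he => (hu' e he.1 not_false he.2).1)
      (fun e e' he he' => hinj e e' he.1 not_false he.2 he'.1 not_false he'.2)
    refine ⟨κ, isDenseColouringOn_of_assignment hu' hself (fun e h1 _ h3 => hκu e ⟨h1, h3⟩)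
      ?_ (fun _ _ _ _ _ _ _ h => h.elim) (fun _ _ _ _ h => h.elim)⟩
    rintro v (hv | ⟨e, he, hev⟩) hvd
    · exact absurd hv hvd
    · left
      by_contra hc
      obtain ⟨x, -, hx, -⟩ := exists_nonAdj_of_not_assigned h hu' hinj he hvd hev
        (fun x h1 h2 h3 h4 => hc ⟨x, h1, h2, h3, h4⟩)
      exact hx
  · obtain ⟨u, hu, hinj⟩ := hC.exists_assignment
    have hu' : ∀ e, IsDense G e → ¬ e = d → (∃ w, IsDense G w ∧ NonAdj G e w) →
        ¬ IsDense G (u e) ∧ ∀ w, IsDense G w → (G.Adj (u e) w ↔ NonAdj G e w) :=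
      fun e h1 h2 h3 => ⟨(hu e h1 h2 h3).1, (hu e h1 h2 h3).2.2⟩
    obtain ⟨κ, hself, hκu, hκd⟩ := exists_colour_of_assignment (G := G) (u := u)
      (p := fun e => IsDense G e ∧ ¬ e = d ∧ ∃ w, IsDense G w ∧ NonAdj G e w) d
      (fun e he => (hu' e he.1 he.2.1 he.2.2).1)
      (fun e e' he he' => hinj e e' he.1 he.2.1 he.2.2 he'.1 he'.2.1 he'.2.2)
    have hleft : ∀ v ∈ core G, ¬ IsDense G v →
        (∀ e, IsDense G e → ¬ e = d → (∃ w, IsDense G w ∧ NonAdj G e w) → u e ≠ v) →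
        IsLeftover G d v := by
      rintro v (hv | ⟨e, he, hev⟩) hvd hna
      · exact absurd hv hvd
      · refine ⟨hvd, ⟨e, he, hev.symm⟩, fun w hw hvw => ?_⟩
        obtain ⟨x, -, rfl, hx⟩ := exists_nonAdj_of_not_assigned h hu' hinj hw hvd hvw.symm hna
        exact hx.symm
    refine ⟨κ, isDenseColouringOn_of_assignment hu' hself
      (fun e h1 h2 h3 => hκu e ⟨h1, h2, h3⟩) ?_ ?_ ?_⟩
    · intro v hv hvd
      refine or_iff_not_imp_left.2 fun hc => ?_
      have hna : ∀ e, IsDense G e → ¬ e = d → (∃ w, IsDense G w ∧ NonAdj G e w) → u e ≠ v :=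
        fun x h1 h2 h3 h4 => hc ⟨x, h1, h2, h3, h4⟩
      rw [hκd v hvd fun e he => hna e he.1 he.2.1 he.2.2]
      exact ⟨hd, rfl, fun ha => ((hleft v hv hvd hna).2.2 d hd ha.symm).1 rfl⟩
    · have hl : ∀ v ∈ core G, ¬ IsDense G v → κ v = d → IsLeftover G d v := by
        intro v hv hvd hvκ
        refine hleft v hv hvd fun e h1 h2 h3 h4 => h2 ?_
        rw [← hκu e ⟨h1, h2, h3⟩, h4, hvκ]
      intro v hv w hw hvd hwd heq hκv
      exact hind v w (hl v hv hvd hκv) (hl w hw hwd (heq ▸ hκv))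
    · rintro e _ he - rfl hed
      obtain ⟨v, hv, hev, hna⟩ := exists_not_assigned h hd
        (fun e h1 h2 h3 => (hu' e h1 h2 h3).2) he hed
      exact ⟨v, hev, hκd v hv fun e he => hna e he.1 he.2.1 he.2.2⟩

end Criterion

end TightB

namespace TightB

/-! ### Necessity of the criterion -/

section Necessity

variable {V : Type*} [Fintype V] {G : SimpleGraph V} {κ : V → V}

namespace IsDenseColouringOn

/-- A dense vertex has only one neighbour of each colour. -/
theorem eq_of_adj (hκ : IsDenseColouringOn (G := G) κ Set.univ) (h : IsTight G) {d u v : V}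
    (hd : IsDense G d) (hu : G.Adj d u) (hv : G.Adj d v) (huv : κ u = κ v) : u = v := by
  classical
  -- κ maps the m(G) - 1 neighbours of d onto the m(G) - 1 other dense vertices, hence injectively.
  have hcard : (G.neighborFinset d).card ≤
      ((Finset.univ.filter fun v : V => IsDense G v).erase d).card := by
    rw [Finset.card_erase_of_mem (by simpa using hd), h.1, ← h.2 d hd,
      SimpleGraph.card_neighborFinset_eq_degree]
    rfl
  have hsurj : Set.SurjOn κ (G.neighborFinset d)
      ((Finset.univ.filter fun v : V => IsDense G v).erase d : Finset V) := by
    intro e he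
    obtain ⟨hed, he⟩ := Finset.mem_erase.1 (Finset.mem_coe.1 he)
    obtain ⟨w, hw, hwe⟩ := hκ.exists_adj d e hd (Finset.mem_filter.1 he).2 hed.symm
    exact ⟨w, by simpa using hw, hwe⟩
  have hmaps : Set.MapsTo κ (G.neighborFinset d)
      ((Finset.univ.filter fun v : V => IsDense G v).erase d : Finset V) := by
    intro w hw
    have hw' : G.Adj d w := by simpa using hw
    refine Finset.mem_coe.2 (Finset.mem_erase.2 ⟨fun heq => ?_, Finset.mem_filter.2
      ⟨Finset.mem_univ _, hκ.dense w trivial⟩⟩)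
    exact hκ.proper d trivial w trivial hw' (by rw [hκ.self d hd, heq])
  exact Finset.injOn_of_surjOn_of_card_le κ hmaps hsurj hcard (by simpa using hu)
    (by simpa using hv) huv

theorem not_adj (hκ : IsDenseColouringOn (G := G) κ Set.univ)
    {u v : V} (huv : κ u = κ v) : ¬ G.Adj u v :=
  fun ha => hκ.proper u trivial v trivial ha huv

theorem not_adj_colour (hκ : IsDenseColouringOn (G := G) κ Set.univ)
    (v : V) : ¬ G.Adj (κ v) v :=
  hκ.not_adj (hκ.self _ (hκ.dense v trivial))

theorem exists_nonDense_adj (hκ : IsDenseColouringOn (G := G) κ Set.univ)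
    {d e : V} (hd : IsDense G d) (he : IsDense G e) (hde : NonAdj G d e) :
    ∃ s, ¬ IsDense G s ∧ κ s = d ∧ G.Adj s e := by
  obtain ⟨s, hs, hsd⟩ := hκ.exists_adj e d he hd hde.1.symm
  refine ⟨s, fun hds => ?_, hsd, hs.symm⟩
  rw [hκ.self s hds] at hsd
  exact hde.2 (hsd ▸ hs.symm)

/-- The dense neighbours of a non-dense vertex are non-neighbours of its colour. -/
theorem nonAdj_of_adj (hκ : IsDenseColouringOn (G := G) κ Set.univ) (h : IsTight G)
    {e u : V} (hu : ¬ IsDense G u) (he : IsDense G e) (hue : G.Adj u e) :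
    NonAdj G (κ u) e := by
  have hd := hκ.dense u trivial
  refine ⟨?_, fun ha => hu ?_⟩
  · rintro rfl
    exact hκ.not_adj_colour u hue.symm
  -- Otherwise e has the two neighbours u and κ u of the same colour, which must coincide.
  · rw [hκ.eq_of_adj h he hue.symm ha.symm (hκ.self _ hd).symm]
    exact hd

end IsDenseColouringOn

/-- The colour class of `d` has two non-dense vertices with dense neighbours. -/
structure IsSplit (κ : V → V) (d s₁ s₂ e₁ e₂ : V) : Prop where
  dense : IsDense G d
  nonDense₁ : ¬ IsDense G s₁
  nonDense₂ : ¬ IsDense G s₂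
  dense₁ : IsDense G e₁
  dense₂ : IsDense G e₂
  colour₁ : κ s₁ = d
  colour₂ : κ s₂ = d
  adj₁ : G.Adj s₁ e₁
  adj₂ : G.Adj s₂ e₂
  ne : s₁ ≠ s₂

/-! ### Colour classes that split -/

namespace IsSplit

variable {d s₁ s₂ e₁ e₂ : V}

theorem swap (hs : IsSplit (G := G) κ d s₁ s₂ e₁ e₂) : IsSplit (G := G) κ d s₂ s₁ e₂ e₁ :=
  ⟨hs.dense, hs.nonDense₂, hs.nonDense₁, hs.dense₂, hs.dense₁, hs.colour₂, hs.colour₁, hs.adj₂,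
    hs.adj₁, hs.ne.symm⟩

theorem nonAdj_left (hs : IsSplit (G := G) κ d s₁ s₂ e₁ e₂)
    (hκ : IsDenseColouringOn (G := G) κ Set.univ) :
    NonAdj G d s₁ := by
  refine ⟨?_, ?_⟩
  · rintro rfl
    exact hs.nonDense₁ hs.dense
  · have := hκ.not_adj_colour s₁
    rwa [hs.colour₁] at this

theorem nonAdj_left_right (hs : IsSplit (G := G) κ d s₁ s₂ e₁ e₂)
    (hκ : IsDenseColouringOn (G := G) κ Set.univ) :
    NonAdj G s₁ s₂ :=
  ⟨hs.ne, hκ.not_adj (hs.colour₁.trans hs.colour₂.symm)⟩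

/-- For every dense non-neighbour `a` of `d`, one of the pairs can be taken to contain `a`. -/
theorem exists_split_of_nonAdj (hs : IsSplit (G := G) κ d s₁ s₂ e₁ e₂)
    (hκ : IsDenseColouringOn (G := G) κ Set.univ)
    {a : V} (ha : IsDense G a) (hda : NonAdj G d a) :
    ∃ s s' e', IsSplit (G := G) κ d s s' a e' := by
  obtain ⟨s, hsd, hsκ, hsa⟩ := hκ.exists_nonDense_adj hs.dense ha hda
  by_cases hs₁ : s = s₁
  · exact ⟨s, s₂, e₂, hs.dense, hsd, hs.nonDense₂, ha, hs.dense₂, hsκ, hs.colour₂, hsa, hs.adj₂,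
      hs₁ ▸ hs.ne⟩
  · exact ⟨s, s₁, e₁, hs.dense, hsd, hs.nonDense₁, ha, hs.dense₁, hsκ, hs.colour₁, hsa, hs.adj₁,
      hs₁⟩

theorem nonAdj_dense (hs : IsSplit (G := G) κ d s₁ s₂ e₁ e₂)
    (hκ : IsDenseColouringOn (G := G) κ Set.univ) (h : IsTight G) :
    NonAdj G d e₁ := by
  have := hκ.nonAdj_of_adj h hs.nonDense₁ hs.dense₁ hs.adj₁
  rwa [hs.colour₁] at this

/-- Otherwise e₂ would see the colour d twice. -/
theorem not_adj_cross (hs : IsSplit (G := G) κ d s₁ s₂ e₁ e₂)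
    (hκ : IsDenseColouringOn (G := G) κ Set.univ) (h : IsTight G) :
    ¬ G.Adj s₁ e₂ := fun ha =>
  hs.ne (hκ.eq_of_adj h hs.dense₂ ha.symm hs.adj₂.symm (hs.colour₁.trans hs.colour₂.symm))

/-- Otherwise the edges s₁e₁, s₂e₂ and the vertex d induce 2P₂ + P₁. -/
theorem adj_dense (hs : IsSplit (G := G) κ d s₁ s₂ e₁ e₂)
    (hκ : IsDenseColouringOn (G := G) κ Set.univ) (h : IsTight G)
    (hF : IsFreeOf twoP2AddP1 G) :
    G.Adj e₁ e₂ := by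
  by_contra ha
  exact hF.false_of_adj hs.adj₁ hs.adj₂ (hs.nonAdj_left_right hκ).2 (hs.not_adj_cross hκ h)
    (fun h' => hs.swap.not_adj_cross hκ h h'.symm) ha (hs.nonAdj_left hκ) (hs.nonAdj_dense hκ h)
    (hs.swap.nonAdj_left hκ) (hs.swap.nonAdj_dense hκ h)

/-- The dense neighbours of `d` are adjacent to the dense non-neighbours of `d`. -/
theorem adj_of_adj_of_nonAdj (hs : IsSplit (G := G) κ d s₁ s₂ e₁ e₂)
    (hκ : IsDenseColouringOn (G := G) κ Set.univ) (h : IsTight G)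
    (hF : IsFreeOf twoP2AddP1 G)
    {f a : V} (hf : IsDense G f) (hdf : G.Adj d f) (ha : IsDense G a)
    (hda : NonAdj G d a) : G.Adj f a := by
  by_contra hfa
  obtain ⟨s, s', e', hs'⟩ := hs.exists_split_of_nonAdj hκ ha hda
  have hnot : ∀ x, ¬ IsDense G x → κ x = d → ¬ G.Adj x f := fun x hx hxd hxf => by
    have := hκ.nonAdj_of_adj h hx hf hxf
    rw [hxd] at this
    exact this.2 hdf
  -- The forbidden subgraph consists of the edges sa, df and the vertex s'.
  refine hF.false_of_adj hs'.adj₁ hdf (fun h' => (hs'.nonAdj_left hκ).2 h'.symm)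
    (hnot s hs'.nonDense₁ hs'.colour₁) (fun h' => hda.2 h'.symm) (fun h' => hfa h'.symm)
    (e := s') (hs'.swap.nonAdj_left_right hκ) ⟨?_, hs'.swap.not_adj_cross hκ h⟩
    (hs'.swap.nonAdj_left hκ).symm ⟨?_, hnot s' hs'.nonDense₂ hs'.colour₂⟩
  · rintro rfl
    exact hs'.nonDense₂ ha
  · rintro rfl
    exact hs'.nonDense₂ hf

/-- At most one colour class splits. -/
theorem eq_of_isSplit (hs : IsSplit (G := G) κ d s₁ s₂ e₁ e₂)
    (hκ : IsDenseColouringOn (G := G) κ Set.univ) (h : IsTight G)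
    (hF : IsFreeOf twoP2AddP1 G)
    {f u₁ u₂ b₁ b₂ : V} (hf : IsSplit (G := G) κ f u₁ u₂ b₁ b₂) : f = d := by
  by_contra hfd
  by_cases hdf : G.Adj d f
  · have hne₁ := hf.nonAdj_dense hκ h
    have hne₂ := hf.swap.nonAdj_dense hκ h
    have hdb₁ := hf.adj_of_adj_of_nonAdj hκ h hF hs.dense hdf.symm hf.dense₁ hne₁
    have hdb₂ := hf.adj_of_adj_of_nonAdj hκ h hF hs.dense hdf.symm hf.dense₂ hne₂
    have hde := hs.nonAdj_dense hκ h
    -- t is a vertex through which d sees the colour e₁. Every dense neighbour of d is adjacent to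
    -- e₁, so none is adjacent to t.
    obtain ⟨t, htd, htκ, hta⟩ := hκ.exists_nonDense_adj hs.dense₁ hs.dense hde.symm
    have ht : ∀ g, IsDense G g → G.Adj d g → ¬ G.Adj t g := fun g hg hdg htg => by
      have := hκ.nonAdj_of_adj h htd hg htg
      rw [htκ] at this
      exact this.2 (hs.adj_of_adj_of_nonAdj hκ h hF hg hdg hs.dense₁ hde).symm
    have hsne : ∀ s, ¬ IsDense G s → κ s = d → ∀ g, IsDense G g → G.Adj d g → ¬ G.Adj s g :=
      fun s hsd hsκ g hg hdg hsg => by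
        have := hκ.nonAdj_of_adj h hsd hg hsg
        rw [hsκ] at this
        exact this.2 hdg
    -- If t were adjacent to s, the edges ts, b₁b₂ and the vertex f would be forbidden.
    have hcontra : ∀ s, ¬ IsDense G s → κ s = d → ¬ G.Adj t s := fun s hsd hsκ hts => by
      refine hF.false_of_adj hts (hf.adj_dense hκ h hF) (ht _ hf.dense₁ hdb₁)
        (ht _ hf.dense₂ hdb₂) (hsne s hsd hsκ _ hf.dense₁ hdb₁) (hsne s hsd hsκ _ hf.dense₂ hdb₂)
        (e := f) ⟨?_, fun h' => ht f hf.dense hdf h'.symm⟩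
        ⟨?_, fun h' => hsne s hsd hsκ f hf.dense hdf h'.symm⟩ hne₁ hne₂
      · rintro rfl
        exact htd hf.dense
      · rintro rfl
        exact hsd hf.dense
    have hte : ¬ G.Adj t e₁ := fun h' => by
      have := hκ.not_adj_colour t
      rw [htκ] at this
      exact this h'.symm
    -- Now the edges td, s₁e₁ and the vertex s₂ are forbidden.
    refine hF.false_of_adj hta hs.adj₁ (hcontra s₁ hs.nonDense₁ hs.colour₁) hte
      (hs.nonAdj_left hκ).2 hde.2 (e := s₂)
      ⟨?_, fun h' => hcontra s₂ hs.nonDense₂ hs.colour₂ h'.symm⟩ (hs.swap.nonAdj_left hκ).symm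
      (hs.swap.nonAdj_left_right hκ) ⟨?_, hs.swap.not_adj_cross hκ h⟩
    · rintro rfl
      exact hs.nonAdj_dense hκ h |>.1 (hs.colour₂.symm.trans htκ)
    · rintro rfl
      exact hs.nonDense₂ hs.dense₁
  · have hdf' : NonAdj G d f := ⟨fun h' => hfd h'.symm, hdf⟩
    obtain ⟨s, s', e', hs'⟩ := hs.exists_split_of_nonAdj hκ hf.dense hdf'
    -- Since e' is adjacent to f, whose class splits, it is adjacent to the non-neighbour d of f;
    -- but e' is a non-neighbour of d.
    have := hf.adj_of_adj_of_nonAdj hκ h hF hs'.dense₂ (hs'.adj_dense hκ h hF) hs.dense hdf'.symm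
    exact (hs'.swap.nonAdj_dense hκ h).2 this.symm

end IsSplit

/-- If the colour class of `e` does not split, then it contains a non-dense vertex whose dense
neighbours are the dense non-neighbours of `e`. -/
theorem IsDenseColouringOn.exists_single (hκ : IsDenseColouringOn (G := G) κ Set.univ)
    (h : IsTight G) {e : V} (he : IsDense G e)
    (hns : ∀ s₁ s₂ e₁ e₂, ¬ IsSplit (G := G) κ e s₁ s₂ e₁ e₂)
    (hw : ∃ w, IsDense G w ∧ NonAdj G e w) :
    ∃ s, ¬ IsDense G s ∧ κ s = e ∧ ∀ w, IsDense G w → (G.Adj s w ↔ NonAdj G e w) := by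
  obtain ⟨w, hwd, hew⟩ := hw
  obtain ⟨s, hsd, hsκ, hsw⟩ := hκ.exists_nonDense_adj he hwd hew
  refine ⟨s, hsd, hsκ, fun x hx => ⟨fun hsx => ?_, fun hex => ?_⟩⟩
  · have := hκ.nonAdj_of_adj h hsd hx hsx
    rwa [hsκ] at this
  · obtain ⟨s', hsd', hsκ', hsx'⟩ := hκ.exists_nonDense_adj he hx hex
    by_cases hss : s = s'
    · rwa [hss]
    · exact absurd ⟨he, hsd, hsd', hwd, hx, hsκ, hsκ', hsw, hsx', hss⟩ (hns s s' w x)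

/-- The colour of s recovers e, so e ↦ s is injective, and it maps the first set counted into the
second. -/
theorem countCondition_of_single {X L : V → Prop}
    (hsingle : ∀ e, IsDense G e → ¬ X e → (∃ w, IsDense G w ∧ NonAdj G e w) →
      ∃ s, ¬ IsDense G s ∧ ¬ L s ∧ κ s = e ∧ ∀ w, IsDense G w → (G.Adj s w ↔ NonAdj G e w)) :
    CountCondition G X L := by
  classical
  rintro e he hX ⟨w, hw, hew⟩
  have hex : ∀ e', IsDense G e' ∧ ¬ X e' ∧
      (∀ w, IsDense G w → (NonAdj G e' w ↔ NonAdj G e w)) →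
      ∃ s, ¬ IsDense G s ∧ ¬ L s ∧ κ s = e' ∧ ∀ w, IsDense G w → (G.Adj s w ↔ NonAdj G e' w) :=
    fun e' he' => hsingle e' he'.1 he'.2.1 ⟨w, hw, (he'.2.2 w hw).2 hew⟩
  have : Nonempty V := ⟨e⟩
  choose! s hs using hex
  refine Finset.card_le_card_of_injOn s ?_ ?_
  · intro e' he'
    have he' := (Finset.mem_filter.1 (Finset.mem_coe.1 he')).2
    obtain ⟨h1, h2, -, h4⟩ := hs e' he'
    exact Finset.mem_coe.2 (Finset.mem_filter.2 ⟨Finset.mem_univ _, h1, h2,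
      fun w hw => (h4 w hw).trans (he'.2.2 w hw)⟩)
  · intro e₁ he₁ e₂ he₂ heq
    have he₁ := (Finset.mem_filter.1 (Finset.mem_coe.1 he₁)).2
    have he₂ := (Finset.mem_filter.1 (Finset.mem_coe.1 he₂)).2
    rw [← (hs e₁ he₁).2.2.1, ← (hs e₂ he₂).2.2.1, heq]

/-- If the class of d splits, the point is that every leftover vertex has colour d. Leftovers are
then independent and disjoint from the vertices matched with the other colours. -/
theorem IsDenseColouringOn.criterion (hκ : IsDenseColouringOn (G := G) κ Set.univ)
    (h : IsTight G) (hF : IsFreeOf twoP2AddP1 G) : Criterion G := by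
  by_cases hsplit : ∃ d s₁ s₂ e₁ e₂, IsSplit (G := G) κ d s₁ s₂ e₁ e₂
  · obtain ⟨d, s₁, s₂, e₁, e₂, hs⟩ := hsplit
    have hns : ∀ e, e ≠ d → ∀ s₁ s₂ e₁ e₂, ¬ IsSplit (G := G) κ e s₁ s₂ e₁ e₂ :=
      fun e hed _ _ _ _ hs' => hed (hs.eq_of_isSplit hκ h hF hs')
    have hleft : ∀ u, IsLeftover G d u → κ u = d := by
      rintro u ⟨hu, ⟨w, hw, huw⟩, hall⟩
      by_contra hne
      have hx := hκ.dense u trivial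
      have hxw := hκ.nonAdj_of_adj h hu hw huw
      obtain ⟨s, hsd, hsκ, hsN⟩ := hκ.exists_single h hx (hns _ hne) ⟨w, hw, hxw⟩
      -- w sees the colour κ u only once, so the dense neighbours of u are exactly the dense
      -- non-neighbours of κ u. If d is adjacent to κ u, then so is w; if not, d is a neighbour of u
      -- and hence its own non-neighbour.
      obtain rfl : u = s := hκ.eq_of_adj h hw huw.symm ((hsN w hw).2 hxw).symm hsκ.symm
      by_cases hdx : G.Adj d (κ u)
      · exact hxw.2 (hs.adj_of_adj_of_nonAdj hκ h hF hx hdx hw (hall w hw huw))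
      · have : NonAdj G (κ u) d := ⟨hne, fun h' => hdx h'.symm⟩
        exact (hall d hs.dense ((hsN d hs.dense).2 this)).1 rfl
    refine Or.inr ⟨d, hs.dense, fun u v hu hv => hκ.not_adj ((hleft u hu).trans (hleft v hv).symm),
      countCondition_of_single (κ := κ) fun e he hed hw => ?_⟩
    obtain ⟨s, hsd, hsκ, hsN⟩ := hκ.exists_single h he (hns e hed) hw
    exact ⟨s, hsd, fun hl => hed (hsκ.symm.trans (hleft s hl)), hsκ, hsN⟩
  · push Not at hsplit
    refine Or.inl (countCondition_of_single (κ := κ) fun e he _ hw => ?_)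
    obtain ⟨s, hsd, hsκ, hsN⟩ := hκ.exists_single h he (hsplit e) hw
    exact ⟨s, hsd, not_false, hsκ, hsN⟩

/-- A tight `(2P₂ + P₁)`-free graph has a tight b-colouring if and only if it satisfies the
criterion. -/
theorem hasTightBColouring_iff_criterion (h : IsTight G) (hF : IsFreeOf twoP2AddP1 G) :
    HasTightBColouring G ↔ Criterion G := by
  constructor
  · intro hc
    obtain ⟨κ, hκ⟩ := hc.exists_isDenseColouringOn h
    exact hκ.criterion h hF
  · intro hC
    obtain ⟨κ, hκ⟩ := hC.exists_isDenseColouringOn h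
    obtain ⟨κ', hκ'⟩ := hκ.exists_extension h
    exact hκ'.hasTightBColouring h

end Necessity

end TightB

namespace TightB

/-! ## The criterion as a counting term -/

namespace CountTerm

/-- Terms as formulas: a formula holds if its value is nonzero. -/
def Holds {n : ℕ} (G : SimpleGraph (Fin n)) (env : ℕ → ℕ) (t : CountTerm) : Prop :=
  t.eval n ((inputState G).arr 0) env ≠ 0

/-- Negation. -/
def neg (t : CountTerm) : CountTerm := minus (lit 1) t

/-- Conjunction. -/
def and (t u : CountTerm) : CountTerm := neg (plus (neg t) (neg u))

/-- Implication. -/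
def imp (t u : CountTerm) : CountTerm := plus (neg t) u

/-- Equivalence. -/
def iff (t u : CountTerm) : CountTerm := and (imp t u) (imp u t)

/-- Universal quantification over the vertices. -/
def all (x : ℕ) (t : CountTerm) : CountTerm := neg (sum x (neg t))

/-- Comparison of values. -/
def le (t u : CountTerm) : CountTerm := neg (minus t u)

/-- The number of vertices that satisfy a formula. -/
def count (x : ℕ) (t : CountTerm) : CountTerm := sum x (neg (neg t))

/-- Equality of two variables. -/
def eqVar (x y : ℕ) : CountTerm := and (le (var x) (var y)) (le (var y) (var x))

/-- Adjacency of two vertices; the sum multiplies by the number of vertices. -/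
def adj (x y : ℕ) : CountTerm := cell (plus (sum 20 (var x)) (var y))

/-- The degree of a vertex. -/
def deg (x : ℕ) : CountTerm := sum 19 (adj x 19)

/-- The vertex has maximum degree. -/
def dense (x : ℕ) : CountTerm := all 18 (le (deg 18) (deg x))

/-- The formula for `NonAdj`. -/
def nonAdj (x y : ℕ) : CountTerm := and (neg (eqVar x y)) (neg (adj x y))

/-- The formula for `IsLeftover`. -/
def leftover (d u : ℕ) : CountTerm :=
  and (neg (dense u)) (and (sum 17 (and (dense 17) (adj u 17)))
    (all 17 (imp (dense 17) (imp (adj u 17) (nonAdj d 17)))))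

/-- The formula for `CountCondition`. -/
def countCondition (X L : ℕ → CountTerm) : CountTerm :=
  all 1 (imp (dense 1) (imp (neg (X 1)) (imp (sum 17 (and (dense 17) (nonAdj 1 17)))
    (le
      (count 2 (and (dense 2) (and (neg (X 2))
        (all 17 (imp (dense 17) (iff (nonAdj 2 17) (nonAdj 1 17)))))))
      (count 2 (and (neg (dense 2)) (and (neg (L 2))
        (all 17 (imp (dense 17) (iff (adj 2 17) (nonAdj 1 17)))))))))))

/-- The formula for `Criterion`. -/
def criterion : CountTerm :=
  plus (countCondition (fun _ => lit 0) (fun _ => lit 0))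
    (sum 0 (and (dense 0) (and
      (all 1 (all 2 (imp (leftover 0 1) (imp (leftover 0 2) (neg (adj 1 2))))))
      (countCondition (fun e => eqVar e 0) (leftover 0)))))

/-! ### Meaning of the formulas -/

section Holds

variable {n : ℕ} {G : SimpleGraph (Fin n)} {env : ℕ → ℕ} {t u : CountTerm} {x y : ℕ} {i j : Fin n}

theorem holds_neg : (neg t).Holds G env ↔ ¬ t.Holds G env := by
  simp only [Holds, neg, eval]; omega

theorem holds_and : (and t u).Holds G env ↔ t.Holds G env ∧ u.Holds G env := by
  simp only [Holds, and, neg, eval]; omega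

theorem holds_plus : (plus t u).Holds G env ↔ t.Holds G env ∨ u.Holds G env := by
  simp only [Holds, eval]; omega

theorem holds_imp : (imp t u).Holds G env ↔ (t.Holds G env → u.Holds G env) := by
  rw [imp, holds_plus, holds_neg, imp_iff_not_or]

theorem holds_iff : (iff t u).Holds G env ↔ (t.Holds G env ↔ u.Holds G env) := by
  rw [iff, holds_and, holds_imp, holds_imp]
  exact iff_iff_implies_and_implies.symm

/-- A sum of natural numbers is nonzero iff some summand is, so sums serve as existential
quantifiers. -/
theorem holds_sum : (sum x t).Holds G env ↔
    ∃ i : Fin n, t.Holds G (Function.update env x i) := by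
  simp only [Holds, eval, ne_eq, Finset.sum_eq_zero_iff, Finset.mem_range, not_forall]
  exact ⟨fun ⟨i, hi, h⟩ => ⟨⟨i, hi⟩, h⟩, fun ⟨i, h⟩ => ⟨i, i.2, h⟩⟩

theorem holds_all : (all x t).Holds G env ↔
    ∀ i : Fin n, t.Holds G (Function.update env x i) := by
  simp only [all, holds_neg, holds_sum, not_exists, not_not]

theorem holds_le : (le t u).Holds G env ↔
    t.eval n ((inputState G).arr 0) env ≤ u.eval n ((inputState G).arr 0) env := by
  simp only [Holds, le, neg, eval]; omega

-- The double negation turns nonzero values into 1, so that summing counts.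
open Classical in
theorem eval_count : (count x t).eval n ((inputState G).arr 0) env =
    (Finset.univ.filter fun i : Fin n => t.Holds G (Function.update env x i)).card := by
  rw [count, eval, Finset.sum_range, Finset.card_filter]
  refine Finset.sum_congr rfl fun i _ => ?_
  by_cases h : t.Holds G (Function.update env x i)
  · rw [if_pos h]
    simp only [Holds, neg, eval] at h ⊢
    omega
  · rw [if_neg h]
    simp only [Holds, neg, eval] at h ⊢
    omega

theorem holds_eqVar (hx : env x = i) (hy : env y = j) : (eqVar x y).Holds G env ↔ i = j := by
  rw [eqVar, holds_and, holds_le, holds_le]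
  simp only [eval, hx, hy, Fin.ext_iff]
  omega

theorem update_eq_of_ne {v : ℕ} (hx : env x = i) (hxy : x ≠ y) :
    Function.update env y v x = i := by
  rw [Function.update_of_ne hxy, hx]

-- As j < n, the index n * i + j determines i and j. Variable 20 is bound by the inner sum and must
-- not be x; the bounds 19, 18 and 17 in later lemmas likewise prevent variable capture.
open Classical in
theorem eval_adj (hx : env x = i) (hy : env y = j) (hx' : x ≠ 20) :
    (adj x y).eval n ((inputState G).arr 0) env = if G.Adj i j then 1 else 0 := by
  simp only [adj, eval, inputState, Function.update_of_ne hx', hx, hy, Finset.sum_const,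
    Finset.card_range, smul_eq_mul, true_and]
  refine if_congr ⟨?_, fun h => ⟨i, j, h, by ring⟩⟩ rfl rfl
  rintro ⟨i', j', h, heq⟩
  have hn : 0 < n := i.pos
  have h1 : (n * i + j) / n = (i' * n + j') / n := by rw [heq]
  rw [Nat.mul_add_div hn, mul_comm, Nat.mul_add_div hn, Nat.div_eq_of_lt j.2,
    Nat.div_eq_of_lt j'.2] at h1
  obtain rfl : i = i' := Fin.ext (by omega)
  obtain rfl : j = j' := Fin.ext (by rw [mul_comm] at heq; omega)
  exact h

theorem holds_adj (hx : env x = i) (hy : env y = j) (hx' : x ≠ 20) :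
    (adj x y).Holds G env ↔ G.Adj i j := by
  rw [Holds, eval_adj hx hy hx']
  split_ifs with h <;> simp [h]

theorem holds_nonAdj (hx : env x = i) (hy : env y = j) (hx' : x ≠ 20) :
    (nonAdj x y).Holds G env ↔ NonAdj G i j := by
  rw [nonAdj, holds_and, holds_neg, holds_neg, holds_eqVar hx hy, holds_adj hx hy hx', NonAdj]

open Classical in
theorem eval_deg (hx : env x = i) (hx' : x < 19) :
    (deg x).eval n ((inputState G).arr 0) env = G.degree i := by
  rw [deg, eval, Finset.sum_range, ← SimpleGraph.card_neighborFinset_eq_degree,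
    SimpleGraph.neighborFinset_eq_filter, Finset.card_filter]
  exact Finset.sum_congr rfl fun j _ =>
    eval_adj (update_eq_of_ne hx (by omega)) (Function.update_self _ _ _) (by omega)

theorem holds_dense (h : IsTight G) (hx : env x = i) (hx' : x < 18) :
    (dense x).Holds G env ↔ IsDense G i := by
  rw [dense, holds_all, h.isDense_iff]
  refine forall_congr' fun j => ?_
  rw [holds_le, eval_deg (Function.update_self _ _ _) (by omega),
    eval_deg (update_eq_of_ne hx (by omega)) (by omega)]

theorem holds_leftover (h : IsTight G) (hx : env x = i) (hy : env y = j) (hx' : x < 17)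
    (hy' : y < 17) : (leftover x y).Holds G env ↔ IsLeftover G i j := by
  rw [leftover, holds_and, holds_and, holds_neg, holds_dense h hy (by omega), holds_sum,
    holds_all, IsLeftover]
  refine and_congr Iff.rfl (and_congr (exists_congr fun w => ?_) (forall_congr' fun w => ?_))
  · rw [holds_and, holds_dense h (Function.update_self _ _ _) (by omega),
      holds_adj (update_eq_of_ne hy (by omega)) (Function.update_self _ _ _) (by omega)]
  · rw [holds_imp, holds_imp, holds_dense h (Function.update_self _ _ _) (by omega),
      holds_adj (update_eq_of_ne hy (by omega)) (Function.update_self _ _ _) (by omega),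
      holds_nonAdj (update_eq_of_ne hx (by omega)) (Function.update_self _ _ _) (by omega)]

theorem card_filter_congr {α : Type*} [Fintype α] {p q : α → Prop} {_ : DecidablePred p}
    {_ : DecidablePred q} (h : ∀ a, p a ↔ q a) :
    (Finset.univ.filter p).card = (Finset.univ.filter q).card :=
  congrArg Finset.card (Finset.filter_congr fun a _ => h a)

/-- The formulas X and L may refer to the exceptional vertex, which is kept in variable 0; hence the
condition that `env'` agrees with `env` there. -/
theorem holds_countCondition (h : IsTight G) {X L : ℕ → CountTerm} {X' L' : Fin n → Prop}
    (hX : ∀ (env' : ℕ → ℕ) (x : ℕ) (i : Fin n), env' 0 = env 0 → env' x = i → x < 17 →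
      ((X x).Holds G env' ↔ X' i))
    (hL : ∀ (env' : ℕ → ℕ) (x : ℕ) (i : Fin n), env' 0 = env 0 → env' x = i → x < 17 →
      ((L x).Holds G env' ↔ L' i)) :
    (countCondition X L).Holds G env ↔ CountCondition G X' L' := by
  classical
  rw [countCondition, holds_all, CountCondition]
  refine forall_congr' fun e => ?_
  set env₁ := Function.update env 1 (e : ℕ)
  have h1 : env₁ 1 = e := Function.update_self _ _ _
  have h0 : env₁ 0 = env 0 := Function.update_of_ne (by omega) _ _
  rw [holds_imp, holds_imp, holds_imp, holds_neg, holds_dense h h1 (by omega),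
    hX env₁ 1 e h0 h1 (by omega), holds_sum, holds_le, eval_count, eval_count]
  have h2 : ∀ i : Fin n, Function.update env₁ 2 (i : ℕ) 2 = i :=
    fun i => Function.update_self _ _ _
  have h21 : ∀ i : Fin n, Function.update env₁ 2 (i : ℕ) 1 = e :=
    fun i => update_eq_of_ne h1 (by omega)
  have h20 : ∀ i : Fin n, Function.update env₁ 2 (i : ℕ) 0 = env 0 :=
    fun i => (Function.update_of_ne (by omega) _ _).trans h0
  refine imp_congr Iff.rfl (imp_congr Iff.rfl (imp_congr (exists_congr fun w => ?_) ?_))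
  · rw [holds_and, holds_dense h (Function.update_self _ _ _) (by omega),
      holds_nonAdj (update_eq_of_ne h1 (by omega)) (Function.update_self _ _ _) (by omega)]
  · refine iff_of_eq (congrArg₂ _ (card_filter_congr fun e' => ?_) (card_filter_congr fun u => ?_))
    · rw [holds_and, holds_and, holds_neg, holds_dense h (h2 e') (by omega),
        hX _ 2 e' (h20 e') (h2 e') (by omega), holds_all]
      refine and_congr Iff.rfl (and_congr Iff.rfl (forall_congr' fun w => ?_))
      rw [holds_imp, holds_iff, holds_dense h (Function.update_self _ _ _) (by omega),
        holds_nonAdj (update_eq_of_ne (h2 e') (by omega)) (Function.update_self _ _ _) (by omega),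
        holds_nonAdj (update_eq_of_ne (h21 e') (by omega)) (Function.update_self _ _ _)
          (by omega)]
    · rw [holds_and, holds_and, holds_neg, holds_neg, holds_dense h (h2 u) (by omega),
        hL _ 2 u (h20 u) (h2 u) (by omega), holds_all]
      refine and_congr Iff.rfl (and_congr Iff.rfl (forall_congr' fun w => ?_))
      rw [holds_imp, holds_iff, holds_dense h (Function.update_self _ _ _) (by omega),
        holds_adj (update_eq_of_ne (h2 u) (by omega)) (Function.update_self _ _ _) (by omega),
        holds_nonAdj (update_eq_of_ne (h21 u) (by omega)) (Function.update_self _ _ _)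
          (by omega)]

theorem holds_criterion (h : IsTight G) : criterion.Holds G env ↔ Criterion G := by
  rw [criterion, holds_plus, holds_sum, Criterion]
  refine or_congr (holds_countCondition h ?_ ?_) (exists_congr fun d => ?_)
  · intro _ _ _ _ _ _; simp [Holds, eval]
  · intro _ _ _ _ _ _; simp [Holds, eval]
  set env₀ := Function.update env 0 (d : ℕ)
  have h0 : env₀ 0 = d := Function.update_self _ _ _
  rw [holds_and, holds_and, holds_dense h h0 (by omega), holds_all,
    holds_countCondition h (X' := fun e => e = d) (L' := IsLeftover G d)
      (fun env' x i h0' hx _ => holds_eqVar hx (h0'.trans h0))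
      (fun env' x i h0' hx hx' => holds_leftover h (h0'.trans h0) hx (by omega) hx')]
  refine and_congr Iff.rfl (and_congr (forall_congr' fun u => ?_) Iff.rfl)
  rw [holds_all]
  refine forall_congr' fun v => ?_
  set env₂ := Function.update (Function.update env₀ 1 (u : ℕ)) 2 (v : ℕ)
  have h20 : env₂ 0 = d := update_eq_of_ne (update_eq_of_ne h0 (by omega)) (by omega)
  have h21 : env₂ 1 = u := update_eq_of_ne (Function.update_self _ _ _) (by omega)
  have h22 : env₂ 2 = v := Function.update_self _ _ _
  rw [holds_imp, holds_imp, holds_neg, holds_leftover h h20 h21 (by omega) (by omega),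
    holds_leftover h h20 h22 (by omega) (by omega), holds_adj h21 h22 (by omega)]

end Holds

end CountTerm

end TightB

/-- Tight b-Chromatic Number (given a tight graph, decide whether it has a tight b-colouring)
is polynomial-time solvable for `(2P₂ + P₁)`-free graphs. -/
theorem mainTheorem5 :
    TightB.PolyTimeSolvableOn
      (fun {_n} G => TightB.IsTight G ∧ TightB.IsFreeOf TightB.twoP2AddP1 G)
      (fun {_n} G => TightB.HasTightBColouring G) :=
  TightB.PolyTimeSolvableOn.of_term TightB.CountTerm.criterion fun _ _ hG =>
    (TightB.CountTerm.holds_criterion hG.1).trans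
      (TightB.hasTightBColouring_iff_criterion hG.1 hG.2).symm
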